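/- Let $p$ be a prime, let $V$ be a vector space of finite dimension $d$ over $\mathbb{F}_p$, and let $H \leq \mathrm{GL}(V)$ act irreducibly on $V$. Let $HV \leq \mathrm{AGL}(V)$ be the (affine primitive) permutation group on $V$ consisting of all maps $x \mapsto h(x)+t$ with $h \in H$, $t \in V$. An orbital graph of $HV$ is a directed graph with vertex set $V$ whose arc set is an orbit of $HV$ on $V \times V$; it is non-diagonal if its arcs do not all lie in $\{(x,x) \mid x \in V\}$. Let $\overrightarrow{\mathrm{diam}}(V,H)$ be the supremum of the directed diameters of the non-diagonal orbital graphs of $HV$, and let $\mathrm{diam}(V,H)$ be the supremum of the diameters of the undirected graphs obtained from the non-diagonal orbital graphs of $HV$ by forgetting the directions of the arcs. Let $A$ be a nontrivial abelian subgroup of $H$ whose order is not divisible by $p$, and let $k$ be the number of irreducible summands in a decomposition of the (completely reducible) $\mathbb{F}_pA$-module $V$ as a direct sum of irreducible $\mathbb{F}_pA$-modules. Then $$\mathrm{diam}(V,H) < 322\, d \cdot 144^{k(k+1)} \cdot |V|^{\frac{k(k+1)\log 4}{\log |A|}}.$$ Moreover, if $A$ is normal in $H$, then $$\overrightarrow{\mathrm{diam}}(V,H)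 < d \cdot 2576^{k(k+1)} \cdot |V|^{\frac{(k+1)\log 4}{\log |A|}}.$$ -/

import Mathlib

/-- The orbital graph of a permutation group `G` on `X` through the pair `a`: the directed graph
with vertex set `X` whose arc set is the `G`-orbit of `a` on `X × X` (with the diagonal action). -/
def orbitalGraph {X : Type*} (G : Subgroup (Equiv.Perm X)) (a : X × X) : Digraph X where
  Adj x y := (x, y) ∈ MulAction.orbit G a

/-- The orbital graph through `a` is non-diagonal: its arcs do not all lie on the diagonal. -/
def IsNonDiagonalOrbital {X : Type*} (G : Subgroup (Equiv.Perm X)) (a : X × X) : Prop :=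
  ∃ x y : X, (orbitalGraph G a).Adj x y ∧ x ≠ y

/-- There is a directed path (walk along the arcs) with exactly `n` arcs from `x` to `y`. -/
def HasDirectedWalk {X : Type*} (D : Digraph X) (n : ℕ) (x y : X) : Prop :=
  ∃ w : ℕ → X, w 0 = x ∧ w n = y ∧ ∀ i < n, D.Adj (w i) (w (i + 1))

/-- The directed distance from `x` to `y`, which is `⊤` if `y` cannot be reached from `x`. -/
noncomputable def directedDist {X : Type*} (D : Digraph X) (x y : X) : ℕ∞ :=
  ⨅ n : {n : ℕ // HasDirectedWalk D n x y}, ((n : ℕ) : ℕ∞)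

/-- The diameter of a directed graph: the supremum of all directed distances. -/
noncomputable def directedDiam {X : Type*} (D : Digraph X) : ℕ∞ :=
  ⨆ x : X, ⨆ y : X, directedDist D x y

/-- The supremum of the directed diameters of the non-diagonal orbital graphs of `G`. -/
noncomputable def directedOrbitalDiam {X : Type*} (G : Subgroup (Equiv.Perm X)) : ℕ∞ :=
  ⨆ a : X × X, ⨆ _ : IsNonDiagonalOrbital G a, directedDiam (orbitalGraph G a)

/-- The supremum of the diameters of the non-diagonal orbital graphs of `G`, where the directions
of the arcs are forgotten. -/
noncomputable def undirectedOrbitalDiam {X : Type*} (G : Subgroup (Equiv.Perm X)) : ℕ∞ :=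
  ⨆ a : X × X, ⨆ _ : IsNonDiagonalOrbital G a, (orbitalGraph G a).toSimpleGraphInclusive.ediam

/-- The affine permutation group `HV ≤ AGL(V)` on the points of `V`: all maps `x ↦ h x + t` with
`h ∈ H` and `t ∈ V`. -/
def affinePermGroup {F V : Type*} [Field F] [AddCommGroup V] [Module F V]
    (H : Subgroup (V ≃ₗ[F] V)) : Subgroup (Equiv.Perm V) where
  carrier := {g | ∃ h ∈ H, ∃ t : V, ∀ x, g x = h x + t}
  one_mem' := ⟨1, H.one_mem, 0, fun x => by simp⟩
  mul_mem' := by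
    rintro g g' ⟨h, hh, t, ht⟩ ⟨h', hh', t', ht'⟩
    refine ⟨h * h', H.mul_mem hh hh', h t' + t, fun x => ?_⟩
    simp [ht, ht', add_assoc]
  inv_mem' := by
    rintro g ⟨h, hh, t, ht⟩
    refine ⟨h⁻¹, H.inv_mem hh, -(h⁻¹ t), fun x => ?_⟩
    rw [Equiv.Perm.inv_eq_iff_eq, ht, map_add, map_neg]
    change x = h (h.symm x) + -h (h.symm t) + t
    simp

/-- The natural representation on `V` of a subgroup of `GL(V)`. -/
def naturalRep {F V : Type*} [Field F] [AddCommGroup V] [Module F V]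
    (H : Subgroup (V ≃ₗ[F] V)) : Representation F H V :=
  (LinearEquiv.automorphismGroup.toLinearMapMonoidHom).comp H.subtype

/-- `V` is the direct sum of the `k` subrepresentations `W 0, …, W (k - 1)`, each of which is
irreducible. -/
def IsIrreducibleDecomposition {F G V : Type*} [Field F] [Group G] [AddCommGroup V] [Module F V]
    (ρ : Representation F G V) {k : ℕ} (W : Fin k → Subrepresentation ρ) : Prop :=
  DirectSum.IsInternal (fun i => (W i).toSubmodule) ∧
    ∀ i, (W i).toRepresentation.IsIrreducible

/-! Translations make an orbital graph a Cayley graph: the arcs are `x → x + s`, with `s` in one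
`H`-orbit `S` of a nonzero vector, or in `S ∪ -S` once directions are forgotten. So it suffices to
write every vector as a short sum of elements of an invariant set. By irreducibility the `H`-orbit
of any `u ≠ 0` contains a basis, so if all multiples `c • u` are sums of `n` elements of `S`, then
every vector is a sum of `d * n`.

Such a line comes from the finite commutative group algebra `R` of `A`, in which `A` generates
additively. The annihilators `J j` of the summands `W j` are maximal, so each `R ⧸ J j` is a finite
field. By `mem_sumsOfAtMost_sumLength`, a multiplicative group with more than one element that
generates a finite field with fewer than `t ^ (L + 1)` elements, `t` being the order of the group,
represents every field element as a sum of `O(L 4 ^ L)` of its members. The proof has three stages: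
a growth argument on quotients of difference sets shows that differences of short sums are
everything; Ruzsa's triangle inequality turns this into large sumsets; a Fourier argument shows that
four summands from such a sumset suffice.

To isolate one summand `W i`, short sums lying in `J j` but not in `J i` are multiplied over all `j`
with `J j ≠ J i`. The product `x` sends a suitable `v` to `u = x • v ≠ 0`, on which `R` acts through
`R ⧸ J i`, so the field theorem applies (`exists_ne_zero_forall_exists_smul_eq`).

It remains to choose `t` and `L`. As `A` embeds in the product of its images in the residue fields,
the largest image has order `t` with `|A| ≤ t ^ k`. In general `|R ⧸ J j| ≤ |V|` gives `|A| ^ L ≤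
|V| ^ k`. If `A` is normal, `H` permutes the data transitively enough that all images and all
residue fields have equal orders `t` and `q`; then `q ^ k ≤ |V|` gives `|A| ^ L ≤ |V|`, which saves
the factor `k` in the exponent. -/

open scoped Pointwise

/-- The set of all sums of at most `n` elements of `S`. -/
def sumsOfAtMost {M : Type*} [AddCommMonoid M] (S : Set M) (n : ℕ) : Set M :=
  {x | ∃ l : Multiset M, l.card ≤ n ∧ (∀ y ∈ l, y ∈ S) ∧ l.sum = x}

/-! ### Calculus of bounded sums -/

section sums

variable {M N : Type*} [AddCommMonoid M] [AddCommMonoid N] {S T : Set M} {m n : ℕ} {x y : M}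

lemma zero_mem_sumsOfAtMost (S : Set M) (n : ℕ) : 0 ∈ sumsOfAtMost S n :=
  ⟨0, by simp, by simp, by simp⟩

lemma sumsOfAtMost_mono (h : m ≤ n) : sumsOfAtMost S m ⊆ sumsOfAtMost S n := by
  rintro x ⟨l, hl, hS, rfl⟩
  exact ⟨l, hl.trans h, hS, rfl⟩

lemma subset_sumsOfAtMost_one : S ⊆ sumsOfAtMost S 1 := fun x hx =>
  ⟨{x}, by simp, by simpa using hx, by simp⟩

lemma add_mem_sumsOfAtMost (hx : x ∈ sumsOfAtMost S m) (hy : y ∈ sumsOfAtMost S n) :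
    x + y ∈ sumsOfAtMost S (m + n) := by
  obtain ⟨l, hl, hS, rfl⟩ := hx
  obtain ⟨l', hl', hS', rfl⟩ := hy
  refine ⟨l + l', by simpa using add_le_add hl hl', fun z hz => ?_, by simp⟩
  rcases Multiset.mem_add.1 hz with hz | hz
  exacts [hS z hz, hS' z hz]

lemma multiset_sum_mem_sumsOfAtMost (l : Multiset M) (h : ∀ y ∈ l, y ∈ sumsOfAtMost S n) :
    l.sum ∈ sumsOfAtMost S (l.card * n) := by
  induction l using Multiset.induction_on with
  | empty => simp [zero_mem_sumsOfAtMost]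
  | cons a l ih =>
    rw [Multiset.sum_cons, Multiset.card_cons, add_mul, one_mul, add_comm a]
    exact add_mem_sumsOfAtMost (ih fun y hy => h y (Multiset.mem_cons_of_mem hy))
      (h a (Multiset.mem_cons_self a l))

lemma sumsOfAtMost_of_forall_mem (h : ∀ y ∈ S, y ∈ sumsOfAtMost T n)
    (hx : x ∈ sumsOfAtMost S m) : x ∈ sumsOfAtMost T (m * n) := by
  obtain ⟨l, hl, hS, rfl⟩ := hx
  exact sumsOfAtMost_mono (Nat.mul_le_mul_right n hl)
    (multiset_sum_mem_sumsOfAtMost l fun y hy => h y (hS y hy))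

lemma map_mem_sumsOfAtMost {T : Set N} (f : M →+ N) (hf : ∀ y ∈ S, f y ∈ T)
    (hx : x ∈ sumsOfAtMost S n) : f x ∈ sumsOfAtMost T n := by
  obtain ⟨l, hl, hS, rfl⟩ := hx
  refine ⟨l.map f, by simpa using hl, fun z hz => ?_, (map_multiset_sum f l).symm⟩
  obtain ⟨y, hy, rfl⟩ := Multiset.mem_map.1 hz
  exact hf y (hS y hy)

lemma exists_map_eq_of_mem_sumsOfAtMost (f : M →+ N) {z : N}
    (hz : z ∈ sumsOfAtMost (f '' S) n) : ∃ x ∈ sumsOfAtMost S n, f x = z := by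
  obtain ⟨l, hl, hS, rfl⟩ := hz
  induction l using Multiset.induction_on generalizing n with
  | empty => exact ⟨0, zero_mem_sumsOfAtMost S n, by simp⟩
  | cons a l ih =>
    rw [Multiset.card_cons] at hl
    obtain ⟨n, rfl⟩ : ∃ n', n = n' + 1 := ⟨n - 1, by omega⟩
    obtain ⟨x, hx, hxl⟩ := ih (n := n) (by omega) fun y hy => hS y (Multiset.mem_cons_of_mem hy)
    obtain ⟨b, hb, rfl⟩ := hS a (Multiset.mem_cons_self a l)
    refine ⟨x + b, add_mem_sumsOfAtMost hx (subset_sumsOfAtMost_one hb), ?_⟩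
    rw [map_add, hxl, Multiset.sum_cons, add_comm]

lemma mul_mem_sumsOfAtMost {R : Type*} [CommSemiring R] {A : Submonoid R} {x y : R} {m n : ℕ}
    (hx : x ∈ sumsOfAtMost (A : Set R) m) (hy : y ∈ sumsOfAtMost (A : Set R) n) :
    x * y ∈ sumsOfAtMost (A : Set R) (m * n) := by
  have := sumsOfAtMost_of_forall_mem (S := (AddMonoidHom.mulRight y) '' (A : Set R))
    (T := (A : Set R)) (n := n) (x := x * y) (m := m) ?_
    (map_mem_sumsOfAtMost (AddMonoidHom.mulRight y) (fun a ha => Set.mem_image_of_mem _ ha) hx)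
  · exact this
  · rintro _ ⟨a, ha, rfl⟩
    exact map_mem_sumsOfAtMost (AddMonoidHom.mulLeft a) (fun b hb => A.mul_mem ha hb) hy

lemma prod_mem_sumsOfAtMost {R ι : Type*} [CommSemiring R] {A : Submonoid R} (s : Finset ι)
    (f : ι → R) {n : ℕ} (hf : ∀ i ∈ s, f i ∈ sumsOfAtMost (A : Set R) n) :
    ∏ i ∈ s, f i ∈ sumsOfAtMost (A : Set R) (n ^ s.card) := by
  classical
  induction s using Finset.induction_on with
  | empty => simpa using subset_sumsOfAtMost_one A.one_mem
  | insert a s ha ih =>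
    rw [Finset.prod_insert ha, Finset.card_insert_of_notMem ha, pow_succ']
    exact mul_mem_sumsOfAtMost (hf a (Finset.mem_insert_self a s))
      (ih fun i hi => hf i (Finset.mem_insert_of_mem hi))

end sums

/-! ### Calculus of differences of bounded sums -/

section differences

variable {R : Type*} [CommRing R] {A : Submonoid R} {m n : ℕ} {x y : R}

/-- The set of all differences of sums of at most `n` elements of `S`. -/
def diffSumsOfAtMost {M : Type*} [AddCommGroup M] (S : Set M) (n : ℕ) : Set M :=
  {z | ∃ x ∈ sumsOfAtMost S n, ∃ y ∈ sumsOfAtMost S n, x - y = z}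

lemma zero_mem_diffSumsOfAtMost (S : Set R) (n : ℕ) : 0 ∈ diffSumsOfAtMost S n :=
  ⟨0, zero_mem_sumsOfAtMost S n, 0, zero_mem_sumsOfAtMost S n, sub_zero 0⟩

lemma add_mem_diffSumsOfAtMost {S : Set R} (hx : x ∈ diffSumsOfAtMost S m)
    (hy : y ∈ diffSumsOfAtMost S n) : x + y ∈ diffSumsOfAtMost S (m + n) := by
  obtain ⟨a, ha, b, hb, rfl⟩ := hx
  obtain ⟨c, hc, d, hd, rfl⟩ := hy
  exact ⟨a + c, add_mem_sumsOfAtMost ha hc, b + d, add_mem_sumsOfAtMost hb hd, by ring⟩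

lemma neg_mem_diffSumsOfAtMost {S : Set R} (hx : x ∈ diffSumsOfAtMost S m) :
    -x ∈ diffSumsOfAtMost S m := by
  obtain ⟨a, ha, b, hb, rfl⟩ := hx
  exact ⟨b, hb, a, ha, by ring⟩

lemma sub_mem_diffSumsOfAtMost {S : Set R} (hx : x ∈ diffSumsOfAtMost S m)
    (hy : y ∈ diffSumsOfAtMost S n) : x - y ∈ diffSumsOfAtMost S (m + n) := by
  rw [sub_eq_add_neg]
  exact add_mem_diffSumsOfAtMost hx (neg_mem_diffSumsOfAtMost hy)

lemma mul_mem_diffSumsOfAtMost {a : R} (ha : a ∈ A)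
    (hx : x ∈ diffSumsOfAtMost (A : Set R) m) : a * x ∈ diffSumsOfAtMost (A : Set R) m := by
  obtain ⟨b, hb, c, hc, rfl⟩ := hx
  exact ⟨a * b, map_mem_sumsOfAtMost (AddMonoidHom.mulLeft a) (fun b hb => A.mul_mem ha hb) hb,
    a * c, map_mem_sumsOfAtMost (AddMonoidHom.mulLeft a) (fun b hb => A.mul_mem ha hb) hc, by ring⟩

lemma sub_mem_diffSumsOfAtMost_one {S : Set R} {a b : R} (ha : a ∈ S) (hb : b ∈ S) :
    a - b ∈ diffSumsOfAtMost S 1 :=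
  ⟨a, subset_sumsOfAtMost_one ha, b, subset_sumsOfAtMost_one hb, rfl⟩

end differences

/-! ### Collision counting and pigeonhole -/

/-- Cauchy–Schwarz over the fibres of `f`: few collisions force a large image. -/
lemma Finset.card_sq_le_card_image_mul {α β : Type*} [DecidableEq α] [DecidableEq β]
    (s : Finset α) (f : α → β) :
    s.card ^ 2 ≤ (s.image f).card * ((s ×ˢ s).filter fun p => f p.1 = f p.2).card := by
  have h1 : s.card = ∑ b ∈ s.image f, (s.filter fun a => f a = b).card :=
    Finset.card_eq_sum_card_image f s
  have h2 : ((s ×ˢ s).filter fun p => f p.1 = f p.2).card =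
      ∑ b ∈ s.image f, (s.filter fun a => f a = b).card ^ 2 := by
    rw [Finset.card_eq_sum_card_fiberwise (f := fun p => f p.1) (t := s.image f)]
    · refine Finset.sum_congr rfl fun b _ => ?_
      rw [sq, ← Finset.card_product]
      congr 1
      ext ⟨x, y⟩
      simp only [Finset.mem_filter, Finset.mem_product]
      constructor
      · rintro ⟨⟨⟨hx, hy⟩, h⟩, rfl⟩
        exact ⟨⟨hx, rfl⟩, hy, h.symm⟩
      · rintro ⟨⟨hx, rfl⟩, hy, h⟩
        exact ⟨⟨⟨hx, hy⟩, h.symm⟩, rfl⟩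
    · intro p hp
      have := (Finset.mem_product.1 (Finset.mem_filter.1 hp).1).1
      exact Finset.mem_coe.2 (Finset.mem_image_of_mem _ this)
  rw [h2]
  conv_lhs => rw [h1]
  exact sq_sum_le_card_mul_sum_sq

/-- Some dilate `ξ * A` has a sumset with `Y` that fills more than half of the field. -/
lemma exists_card_lt_two_mul_card_image {K : Type*} [Field K] [Fintype K] [DecidableEq K]
    (Y A : Finset K) (h : Fintype.card K ≤ Y.card * A.card) :
    ∃ ξ : K, Fintype.card K < 2 * ((Y ×ˢ A).image fun p => p.1 + ξ * p.2).card := by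
  set S := Y ×ˢ A with hS
  set q := Fintype.card K
  have hn : S.card = Y.card * A.card := Finset.card_product _ _
  have hq : 0 < q := Fintype.card_pos
  have hnq : q ≤ S.card := hn ▸ h
  set E : K → ℕ := fun ξ =>
    ((S ×ˢ S).filter fun p => p.1.1 + ξ * p.1.2 = p.2.1 + ξ * p.2.2).card with hE
  -- Two different pairs collide for at most one `ξ`, since the collision is a linear equation in
  -- `ξ`. Summed over `ξ`, there are fewer than `2 * S.card ^ 2` collisions, so some `ξ` has at most
  -- the average number.
  have hpair : ∀ p ∈ S ×ˢ S,
      (Finset.univ.filter fun ξ : K => p.1.1 + ξ * p.1.2 = p.2.1 + ξ * p.2.2).card ≤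
        if p.1 = p.2 then q else 1 := by
    rintro ⟨⟨y, a⟩, y', a'⟩ -
    split_ifs with hp
    · exact Finset.card_le_univ _
    · refine Finset.card_le_one.2 fun ξ hξ η hη => ?_
      simp only [Finset.mem_filter, Finset.mem_univ, true_and] at hξ hη
      by_contra hne
      have h1 : (ξ - η) * (a - a') = 0 := by linear_combination hξ - hη
      have h2 : a = a' := sub_eq_zero.1 ((mul_eq_zero.1 h1).resolve_left (sub_ne_zero.2 hne))
      subst h2
      exact hp (by simpa using hξ)
  have hsum : ∑ ξ, E ξ ≤ S.card * q + (S.card * S.card - S.card) := by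
    have h1 : ∑ ξ, E ξ = ∑ p ∈ S ×ˢ S,
        (Finset.univ.filter fun ξ : K => p.1.1 + ξ * p.1.2 = p.2.1 + ξ * p.2.2).card := by
      simp only [hE, Finset.card_filter]
      exact Finset.sum_comm
    rw [h1]
    refine (Finset.sum_le_sum hpair).trans ?_
    rw [Finset.sum_ite, Finset.sum_const, Finset.sum_const, smul_eq_mul, smul_eq_mul, mul_one]
    have hd : ((S ×ˢ S).filter fun p => p.1 = p.2).card = S.card := by
      rw [← Finset.diag_card S]; congr 1; ext ⟨x, y⟩; simp; aesop
    have hd' : ((S ×ˢ S).filter fun p => ¬ p.1 = p.2).card = S.card * S.card - S.card := by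
      rw [← Finset.offDiag_card S]; congr 1; ext ⟨x, y⟩; simp; tauto
    rw [hd, hd']
  have hlt : ∑ ξ, q * E ξ < ∑ _ξ : K, (2 * S.card ^ 2) := by
    rw [← Finset.mul_sum, Finset.sum_const, Finset.card_univ, smul_eq_mul]
    refine Nat.mul_lt_mul_of_pos_left (hsum.trans_lt ?_) hq
    have h3 : S.card ≤ S.card * S.card := Nat.le_mul_self _
    have h4 : S.card * q ≤ S.card * S.card := Nat.mul_le_mul_left _ hnq
    rw [sq]
    omega
  obtain ⟨ξ, -, hξ⟩ := Finset.exists_lt_of_sum_lt hlt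
  refine ⟨ξ, ?_⟩
  by_contra! hc
  have h5 := Finset.card_sq_le_card_image_mul S fun p => p.1 + ξ * p.2
  have h6 : 2 * S.card ^ 2 ≤ q * E ξ := by
    calc 2 * S.card ^ 2 ≤ 2 * ((S.image fun p => p.1 + ξ * p.2).card * E ξ) :=
          Nat.mul_le_mul_left 2 h5
      _ = (2 * (S.image fun p => p.1 + ξ * p.2).card) * E ξ := by ring
      _ ≤ q * E ξ := Nat.mul_le_mul_right _ hc
  omega

/-- Two elements of a set filling more than half of a finite group have arbitrary sum. -/
lemma exists_add_eq_of_card_lt {G : Type*} [AddCommGroup G] [Fintype G] [DecidableEq G]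
    (Y : Finset G) (h : Fintype.card G < 2 * Y.card) (z : G) : ∃ x ∈ Y, ∃ y ∈ Y, x + y = z := by
  have hc : (Y.image fun y => z - y).card = Y.card :=
    Finset.card_image_of_injective _ sub_right_injective
  obtain ⟨x, hx⟩ : (Y ∩ Y.image fun y => z - y).Nonempty := by
    rw [Finset.nonempty_iff_ne_empty]
    intro he
    have := Finset.card_union_of_disjoint (Finset.disjoint_iff_inter_eq_empty.2 he)
    have h2 := Finset.card_le_univ (Y ∪ Y.image fun y => z - y)
    omega
  obtain ⟨hx, hx'⟩ := Finset.mem_inter.1 hx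
  obtain ⟨y, hy, rfl⟩ := Finset.mem_image.1 hx'
  exact ⟨_, hx, y, hy, by abel⟩

/-! ### Fourier analysis: four summands suffice -/

section fourier

variable {G : Type*} [AddCommGroup G] [Fintype G] [DecidableEq G]

/-- Parseval's identity for the indicator function of `X`. -/
lemma sum_norm_sq_sum_addChar (X : Finset G) :
    ∑ χ : AddChar G ℂ, ‖∑ x ∈ X, χ x‖ ^ 2 = Fintype.card G * X.card := by
  have h : ∀ χ : AddChar G ℂ, ((‖∑ x ∈ X, χ x‖ ^ 2 : ℝ) : ℂ) =
      ∑ x ∈ X, ∑ y ∈ X, χ (x - y) := by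
    intro χ
    rw [Complex.ofReal_pow, ← Complex.mul_conj', map_sum, Finset.sum_mul_sum]
    refine Finset.sum_congr rfl fun x _ => Finset.sum_congr rfl fun y _ => ?_
    rw [sub_eq_add_neg, AddChar.map_add_eq_mul, AddChar.map_neg_eq_conj]
  have h2 : ((∑ χ : AddChar G ℂ, ‖∑ x ∈ X, χ x‖ ^ 2 : ℝ) : ℂ) = Fintype.card G * X.card := by
    rw [Complex.ofReal_sum, Finset.sum_congr rfl fun χ _ => h χ, Finset.sum_comm]
    have : ∀ x ∈ X, ∑ χ : AddChar G ℂ, ∑ y ∈ X, χ (x - y) = Fintype.card G := by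
      intro x hx
      rw [Finset.sum_comm]
      simp only [AddChar.sum_apply_eq_ite, sub_eq_zero]
      rw [Finset.sum_ite_eq X x, if_pos hx]
    rw [Finset.sum_congr rfl this, Finset.sum_const, nsmul_eq_mul, mul_comm]
  exact_mod_cast h2

/-- By orthogonality the left side is `|G|` times the number of representations of `z` as a sum of
four elements of `X`. -/
lemma sum_sum_addChar_pow_four_mul_eq_zero (X : Finset G) (z : G)
    (h : ∀ x ∈ X, ∀ y ∈ X, ∀ x' ∈ X, ∀ y' ∈ X, x + y + (x' + y') ≠ z) :
    ∑ χ : AddChar G ℂ, (∑ x ∈ X, χ x) ^ 4 * χ (-z) = 0 := by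
  have h1 : ∀ χ : AddChar G ℂ, (∑ x ∈ X, χ x) ^ 4 * χ (-z) =
      ∑ p ∈ (X ×ˢ X) ×ˢ (X ×ˢ X), χ (p.1.1 + p.1.2 + (p.2.1 + p.2.2) - z) := by
    intro χ
    rw [show (∑ x ∈ X, χ x) ^ 4 = ((∑ x ∈ X, χ x) * ∑ x ∈ X, χ x) *
      ((∑ x ∈ X, χ x) * ∑ x ∈ X, χ x) by ring, Finset.sum_mul_sum, ← Finset.sum_product',
      Finset.sum_mul_sum, ← Finset.sum_product', Finset.sum_mul]
    refine Finset.sum_congr rfl fun p _ => ?_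
    rw [sub_eq_add_neg, AddChar.map_add_eq_mul, AddChar.map_add_eq_mul, AddChar.map_add_eq_mul,
      AddChar.map_add_eq_mul]
  rw [Finset.sum_congr rfl fun χ _ => h1 χ, Finset.sum_comm]
  refine Finset.sum_eq_zero fun p hp => ?_
  simp only [Finset.mem_product] at hp
  rw [AddChar.sum_apply_eq_ite, if_neg]
  exact sub_ne_zero.2 (h _ hp.1.1 _ hp.1.2 _ hp.2.1 _ hp.2.2)

end fourier

/-- A nontrivial additive character has a small sum over a set that is invariant under many
dilations. -/
lemma card_mul_norm_sq_sum_addChar_le {K : Type*} [Field K] [Fintype K] [DecidableEq K]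
    (X A : Finset K) (hA : 0 ∉ A) (hX : ∀ a ∈ A, ∀ x ∈ X, a * x ∈ X)
    (χ : AddChar K ℂ) (hχ : χ ≠ 1) :
    A.card * ‖∑ x ∈ X, χ x‖ ^ 2 ≤
      ∑ ψ ∈ Finset.univ.erase (1 : AddChar K ℂ), ‖∑ x ∈ X, ψ x‖ ^ 2 := by
  classical
  -- The dilates of `χ` by elements of `A` are distinct and nontrivial, and by invariance of `X`
  -- they all have the same sum over `X`.
  set f : K → AddChar K ℂ := fun a => χ.compAddMonoidHom (AddMonoidHom.mulLeft a) with hf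
  have hfa : ∀ a x, f a x = χ (a * x) := fun a x => rfl
  have hinj : Function.Injective f := by
    intro a b hab
    by_contra hne
    refine hχ (DFunLike.ext _ _ fun x => ?_)
    have h1 := congrArg (fun ψ : AddChar K ℂ => ψ ((a - b)⁻¹ * x)) hab
    simp only [hfa] at h1
    have h2 : x = a * ((a - b)⁻¹ * x) - b * ((a - b)⁻¹ * x) := by
      field_simp [sub_ne_zero.2 hne]
    rw [h2, AddChar.map_sub_eq_div, h1, div_self (norm_ne_zero_iff.1 (by simp)),
      AddChar.one_apply]
  have hsum : ∀ a ∈ A, ∑ x ∈ X, f a x = ∑ x ∈ X, χ x := by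
    intro a ha
    have ha0 : a ≠ 0 := fun h => hA (h ▸ ha)
    have himg : X.image (fun x => a * x) = X := by
      refine Finset.eq_of_subset_of_card_le (Finset.image_subset_iff.2 (hX a ha)) ?_
      rw [Finset.card_image_of_injective _ (mul_right_injective₀ ha0)]
    conv_rhs => rw [← himg]
    rw [Finset.sum_image fun x _ y _ h => mul_right_injective₀ ha0 h]
    exact Finset.sum_congr rfl fun x _ => hfa a x
  have hne : ∀ a ∈ A, f a ∈ Finset.univ.erase (1 : AddChar K ℂ) := by
    intro a ha
    refine Finset.mem_erase.2 ⟨fun h => ?_, Finset.mem_univ _⟩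
    have : f a = f 0 := by
      rw [h]; ext x; simp [hfa]
    exact hA (hinj this ▸ ha)
  calc (A.card : ℝ) * ‖∑ x ∈ X, χ x‖ ^ 2 = ∑ a ∈ A, ‖∑ x ∈ X, f a x‖ ^ 2 := by
        have (a) (ha : a ∈ A) : ‖∑ x ∈ X, f a x‖ ^ 2 = ‖∑ x ∈ X, χ x‖ ^ 2 := by rw [hsum a ha]
        rw [Finset.sum_congr rfl this, Finset.sum_const, nsmul_eq_mul]
    _ = ∑ ψ ∈ A.image f, ‖∑ x ∈ X, ψ x‖ ^ 2 := by
        rw [Finset.sum_image fun x _ y _ h => hinj h]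
    _ ≤ _ := Finset.sum_le_sum_of_subset_of_nonneg (Finset.image_subset_iff.2 hne)
        fun _ _ _ => by positivity

/-- A large set invariant under many dilations is an additive basis of order four. -/
lemma exists_sum_four_eq {K : Type*} [Field K] [Fintype K] [DecidableEq K]
    (X A : Finset K) (hA : 0 ∉ A) (hX : ∀ a ∈ A, ∀ x ∈ X, a * x ∈ X) (hne : X.Nonempty)
    (hcard : Fintype.card K ^ 2 ≤ X.card ^ 2 * A.card) (z : K) :
    ∃ x ∈ X, ∃ y ∈ X, ∃ x' ∈ X, ∃ y' ∈ X, x + y + (x' + y') = z := by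
  classical
  by_contra! h
  have h0 := sum_sum_addChar_pow_four_mul_eq_zero X z h
  set S : AddChar K ℂ → ℂ := fun χ => ∑ x ∈ X, χ x with hS
  set P : ℝ := ∑ ψ ∈ Finset.univ.erase (1 : AddChar K ℂ), ‖S ψ‖ ^ 2 with hP
  have hS1 : S 1 = X.card := by simp [hS]
  have hPeq : (X.card : ℝ) ^ 2 + P = Fintype.card K * X.card := by
    rw [← sum_norm_sq_sum_addChar X, ← Finset.add_sum_erase _ _ (Finset.mem_univ 1)]
    change _ = ‖S 1‖ ^ 2 + P
    rw [hS1]; simp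
  have hP0 : 0 ≤ P := Finset.sum_nonneg fun _ _ => by positivity
  have hXpos : (0 : ℝ) < X.card := by exact_mod_cast hne.card_pos
  -- If `z` is not represented, the nontrivial characters must cancel the contribution `|X| ^ 4` of
  -- the trivial one. But their fourth moment is at most `P ^ 2 / |A|`, and `P < |K| |X|`, which
  -- contradicts `hcard`.
  have hmain : (X.card : ℝ) ^ 4 ≤ ∑ ψ ∈ Finset.univ.erase (1 : AddChar K ℂ), ‖S ψ‖ ^ 4 := by
    rw [← Finset.add_sum_erase _ _ (Finset.mem_univ 1)] at h0
    have h1 := congrArg norm (eq_neg_of_add_eq_zero_left h0)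
    rw [norm_neg] at h1
    have h2 : ‖(∑ x ∈ X, (1 : AddChar K ℂ) x) ^ 4 * (1 : AddChar K ℂ) (-z)‖ =
        (X.card : ℝ) ^ 4 := by simp
    rw [← h2, h1]
    refine (norm_sum_le _ _).trans (Finset.sum_le_sum fun ψ _ => ?_)
    rw [norm_mul, norm_pow, AddChar.norm_apply, mul_one]
  have hle : (A.card : ℝ) * ∑ ψ ∈ Finset.univ.erase (1 : AddChar K ℂ), ‖S ψ‖ ^ 4 ≤ P * P := by
    conv_rhs => rw [hP, Finset.mul_sum]
    rw [Finset.mul_sum]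
    refine Finset.sum_le_sum fun ψ hψ => ?_
    have := card_mul_norm_sq_sum_addChar_le X A hA hX ψ (Finset.mem_erase.1 hψ).1
    calc (A.card : ℝ) * ‖S ψ‖ ^ 4 = (A.card * ‖S ψ‖ ^ 2) * ‖S ψ‖ ^ 2 := by ring
      _ ≤ P * ‖S ψ‖ ^ 2 := mul_le_mul_of_nonneg_right this (by positivity)
  have hc : ((Fintype.card K : ℝ)) ^ 2 ≤ (X.card : ℝ) ^ 2 * A.card := by exact_mod_cast hcard
  have hPlt : P < Fintype.card K * X.card := by nlinarith
  have h3 : P * P < (Fintype.card K * X.card) * (Fintype.card K * X.card) :=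
    mul_self_lt_mul_self hP0 hPlt
  have h4 : (A.card : ℝ) * (X.card : ℝ) ^ 4 ≤ P * P :=
    (mul_le_mul_of_nonneg_left hmain (by positivity)).trans hle
  have h5 : (Fintype.card K : ℝ) ^ 2 * (X.card : ℝ) ^ 2 ≤ (X.card : ℝ) ^ 2 * A.card * X.card ^ 2 :=
    mul_le_mul_of_nonneg_right hc (by positivity)
  nlinarith

/-! ### Sums of elements of a multiplicative subgroup of a finite field -/

section field

variable {K : Type*} [Field K] [Fintype K] {A : Submonoid K}

lemma Submonoid.inv_mem_of_finite_field (hA : 0 ∉ A) {a : K} (ha : a ∈ A) : a⁻¹ ∈ A := by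
  have ha0 : a ≠ 0 := fun h => hA (h ▸ ha)
  have h1 := FiniteField.pow_card_sub_one_eq_one a ha0
  have h2 : a⁻¹ = a ^ (Fintype.card K - 2) := by
    have : Fintype.card K - 1 = (Fintype.card K - 2) + 1 := by
      have := Fintype.one_lt_card (α := K)
      omega
    rw [this, pow_succ] at h1
    exact (eq_inv_of_mul_eq_one_left h1).symm
  exact h2 ▸ A.pow_mem ha _

/-- `ξ` is a quotient of an element of `D (2 m)`, where `D` denotes the differences of sums of
elements of `A`, by a nonzero element of `A - A`. -/
def IsDiffQuotient (A : Submonoid K) (m : ℕ) (ξ : K) : Prop :=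
  ∃ a ∈ A, ∃ b ∈ A, a ≠ b ∧ ξ * (a - b) ∈ diffSumsOfAtMost (A : Set K) (2 * m)

-- As `A` generates `K` additively and the set of quotients contains `0` but not `η`, adding some `a
-- ∈ A` leads from a quotient `r` to a non-quotient `r + a`. Then `(x, d) ↦ x + (r + a) * d` is
-- injective on `D m × A`, for a collision would exhibit `r + a` as a quotient. Multiplying by the
-- denominator `b - c` of `r` moves the image into `D (4 * m + 1)`.
open Classical in
lemma card_mul_card_diffSums_le {m : ℕ} (hA2 : ∃ a ∈ A, ∃ b ∈ A, a ≠ b)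
    (hgen : AddSubmonoid.closure (A : Set K) = ⊤) {η : K} (hη : ¬ IsDiffQuotient A m η) :
    (diffSumsOfAtMost (A : Set K) m).toFinset.card * (A : Set K).toFinset.card ≤
      (diffSumsOfAtMost (A : Set K) (4 * m + 1)).toFinset.card := by
  obtain ⟨r, hr, a, ha, hra⟩ : ∃ r, IsDiffQuotient A m r ∧ ∃ a ∈ A, ¬ IsDiffQuotient A m (r + a) := by
    by_contra! hcl
    refine hη ?_
    have hmem : η ∈ AddSubmonoid.closure (A : Set K) := hgen ▸ AddSubmonoid.mem_top η
    induction hmem using AddSubmonoid.closure_induction_right with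
    | zero =>
      obtain ⟨a, ha, b, hb, hab⟩ := hA2
      exact ⟨a, ha, b, hb, hab, by rw [zero_mul]; exact zero_mem_diffSumsOfAtMost _ _⟩
    | add_right x hx y hy ih => exact hcl x (by_contra fun h => hη (absurd (ih h) h)) y hy
  obtain ⟨b, hb, c, hc, hbc, hD⟩ := hr
  have hbc0 : b - c ≠ 0 := sub_ne_zero.2 hbc
  rw [← Finset.card_product]
  refine Finset.card_le_card_of_injOn (fun p => (b - c) * (p.1 + (r + a) * p.2)) ?_ ?_
  · rintro ⟨x, d⟩ hp
    simp only [Finset.coe_product, Set.coe_toFinset, Set.mem_prod] at hp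
    obtain ⟨hx, hd⟩ := hp
    rw [Set.coe_toFinset]
    have h1 : (b - c) * (x + (r + a) * d) =
        (b * x - c * x) + d * (r * (b - c)) + (d * a * b - d * a * c) := by ring
    have h2 := add_mem_diffSumsOfAtMost (add_mem_diffSumsOfAtMost
      (sub_mem_diffSumsOfAtMost (mul_mem_diffSumsOfAtMost hb hx) (mul_mem_diffSumsOfAtMost hc hx))
      (mul_mem_diffSumsOfAtMost hd hD)) (sub_mem_diffSumsOfAtMost_one
        (A.mul_mem (A.mul_mem hd ha) hb) (A.mul_mem (A.mul_mem hd ha) hc))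
    change (b - c) * (x + (r + a) * d) ∈ _
    rw [h1]
    convert h2 using 1
    ring_nf
  · rintro ⟨x, d⟩ hp ⟨y, e⟩ hp' heq
    simp only [Finset.coe_product, Set.coe_toFinset, Set.mem_prod] at hp hp'
    have h1 : x + (r + a) * d = y + (r + a) * e := mul_left_cancel₀ hbc0 heq
    have h2 : d = e := by
      by_contra hde
      refine hra ⟨d, hp.2, e, hp'.2, hde, ?_⟩
      rw [show (r + a) * (d - e) = y - x by linear_combination h1, two_mul]
      exact sub_mem_diffSumsOfAtMost hp'.1 hp.1
    subst h2
    rw [add_right_cancel h1]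

/-- The number of summands after `j` steps of the growth argument. -/
def growthLength : ℕ → ℕ
  | 0 => 0
  | j + 1 => 4 * growthLength j + 1

lemma growthLength_le (j : ℕ) : growthLength j ≤ 4 ^ j := by
  have : 3 * growthLength j + 1 = 4 ^ j := by
    induction j with
    | zero => rfl
    | succ j ih => rw [growthLength, pow_succ]; omega
  omega

lemma diffSumsOfAtMost_mono {M : Type*} [AddCommGroup M] {S : Set M} {m n : ℕ} (h : m ≤ n) :
    diffSumsOfAtMost S m ⊆ diffSumsOfAtMost S n := by
  rintro _ ⟨x, hx, y, hy, rfl⟩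
  exact ⟨x, sumsOfAtMost_mono h hx, y, sumsOfAtMost_mono h hy, rfl⟩

-- Each failure multiplies the size of the difference set by `|A|`; starting from `D 0 = {0}`, after
-- `L + 1` failures it would exceed `|K|`.
open Classical in
lemma isDiffQuotient_growthLength (hA2 : ∃ a ∈ A, ∃ b ∈ A, a ≠ b)
    (hgen : AddSubmonoid.closure (A : Set K) = ⊤) {L : ℕ}
    (hL : Fintype.card K < (A : Set K).toFinset.card ^ (L + 1)) (ξ : K) :
    IsDiffQuotient A (growthLength L) ξ := by
  have key : ∀ j, (¬ IsDiffQuotient A (growthLength j) ξ) →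
      (A : Set K).toFinset.card ^ (j + 1) ≤
        (diffSumsOfAtMost (A : Set K) (growthLength (j + 1))).toFinset.card := by
    intro j
    induction j with
    | zero =>
      intro h
      refine le_trans ?_ (card_mul_card_diffSums_le hA2 hgen h)
      rw [pow_one]
      refine Nat.le_mul_of_pos_left _ (Finset.card_pos.2 ⟨0, ?_⟩)
      rw [Set.mem_toFinset]
      exact zero_mem_diffSumsOfAtMost _ _
    | succ j ih =>
      intro h
      refine le_trans ?_ (card_mul_card_diffSums_le hA2 hgen h)
      rw [pow_succ]
      refine Nat.mul_le_mul_right _ (ih fun ⟨a, ha, b, hb, hab, hD⟩ => h ⟨a, ha, b, hb, hab, ?_⟩)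
      refine diffSumsOfAtMost_mono ?_ hD
      rw [growthLength]
      omega
  by_contra h
  exact absurd ((key L h).trans (Finset.card_le_univ _)) (by omega)

open Classical in
lemma card_le_card_diffSums_mul (hA : 0 ∉ A) {m : ℕ} (h : ∀ ξ, IsDiffQuotient A m ξ) :
    Fintype.card K ≤
      (diffSumsOfAtMost (A : Set K) (2 * m)).toFinset.card * (A : Set K).toFinset.card := by
  rw [← Finset.card_product, ← Finset.card_univ]
  -- Dividing numerator and denominator by `b ∈ A` brings the denominator into `A - 1`, so one
  -- element of `A` suffices to encode it.
  refine Finset.card_le_card_of_surjOn (fun p => p.1 / (p.2 - 1)) fun ξ _ => ?_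
  obtain ⟨a, ha, b, hb, hab, hD⟩ := h ξ
  have hb0 : b ≠ 0 := fun h => hA (h ▸ hb)
  refine ⟨(b⁻¹ * (ξ * (a - b)), b⁻¹ * a), ?_, ?_⟩
  · simp only [Finset.coe_product, Set.coe_toFinset, Set.mem_prod]
    have hb' := Submonoid.inv_mem_of_finite_field hA hb
    exact ⟨mul_mem_diffSumsOfAtMost hb' hD, A.mul_mem hb' ha⟩
  · have hab0 : a - b ≠ 0 := sub_ne_zero.2 hab
    change b⁻¹ * (ξ * (a - b)) / (b⁻¹ * a - 1) = ξ
    rw [show b⁻¹ * a - 1 = b⁻¹ * (a - b) by field_simp]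
    field_simp

-- Some `D (2 * m) + ξ * A` fills more than half of `K`, and multiplication by the denominator of
-- `ξ` puts it inside `D (6 * m)`. Two such elements have any prescribed sum.
open Classical in
lemma diffSums_eq_univ (hA : 0 ∉ A) {m : ℕ} (h : ∀ ξ, IsDiffQuotient A m ξ) (z : K) :
    z ∈ diffSumsOfAtMost (A : Set K) (12 * m) := by
  obtain ⟨ξ, hξ⟩ := exists_card_lt_two_mul_card_image _ _ (card_le_card_diffSums_mul hA h)
  obtain ⟨a, ha, b, hb, hab, hD⟩ := h ξ
  have hab0 : a - b ≠ 0 := sub_ne_zero.2 hab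
  obtain ⟨x, hx, y, hy, hxy⟩ := exists_add_eq_of_card_lt _ hξ ((a - b)⁻¹ * z)
  have key : ∀ x ∈ ((diffSumsOfAtMost (A : Set K) (2 * m)).toFinset ×ˢ
      (A : Set K).toFinset).image (fun p => p.1 + ξ * p.2),
      (a - b) * x ∈ diffSumsOfAtMost (A : Set K) (6 * m) := by
    intro x hx
    obtain ⟨⟨y, d⟩, hp, rfl⟩ := Finset.mem_image.1 hx
    simp only [Finset.mem_product, Set.mem_toFinset] at hp
    have h2 := add_mem_diffSumsOfAtMost (sub_mem_diffSumsOfAtMost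
      (mul_mem_diffSumsOfAtMost ha hp.1) (mul_mem_diffSumsOfAtMost hb hp.1))
      (mul_mem_diffSumsOfAtMost hp.2 hD)
    rw [show 6 * m = 2 * m + 2 * m + 2 * m by ring]
    convert h2 using 1
    ring
  have h3 := add_mem_diffSumsOfAtMost (key x hx) (key y hy)
  rw [← mul_add (a - b) x y, hxy, mul_inv_cancel_left₀ hab0] at h3
  convert h3 using 1
  ring_nf

-- This says `|X| ≥ |G| ^ (1 - 1 / 2 ^ (r + 1))` for the sumset `X`. Since `X - X` is everything,
-- Ruzsa's inequality gives `|G| |X| ≤ |X + X| ^ 2`, so each doubling halves the defect in the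
-- exponent.
open Classical in
lemma card_pow_le_card_sumsOfAtMost_pow {G : Type*} [AddCommGroup G] [Fintype G] {S : Set G}
    {m : ℕ} (h : ∀ z, z ∈ diffSumsOfAtMost S m) (r : ℕ) :
    Fintype.card G ^ (2 ^ (r + 1)) ≤
      (sumsOfAtMost S (2 ^ r * m)).toFinset.card ^ (2 ^ (r + 1)) * Fintype.card G := by
  have hdiff : ∀ r, (sumsOfAtMost S (2 ^ r * m)).toFinset - (sumsOfAtMost S (2 ^ r * m)).toFinset =
      Finset.univ := by
    intro r
    refine Finset.eq_univ_of_forall fun z => ?_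
    obtain ⟨x, hx, y, hy, rfl⟩ := h z
    have hle : m ≤ 2 ^ r * m := Nat.le_mul_of_pos_left _ (by positivity)
    exact Finset.sub_mem_sub (Set.mem_toFinset.2 (sumsOfAtMost_mono hle hx))
      (Set.mem_toFinset.2 (sumsOfAtMost_mono hle hy))
  induction r with
  | zero =>
    have h1 := Finset.card_sub_le (s := (sumsOfAtMost S (2 ^ 0 * m)).toFinset)
      (t := (sumsOfAtMost S (2 ^ 0 * m)).toFinset)
    rw [hdiff, Finset.card_univ] at h1
    calc Fintype.card G ^ (2 ^ (0 + 1)) = Fintype.card G * Fintype.card G := by ring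
      _ ≤ _ := Nat.mul_le_mul_right _ h1
      _ = _ := by ring
  | succ r ih =>
    set X := (sumsOfAtMost S (2 ^ r * m)).toFinset with hX
    set Z := (sumsOfAtMost S (2 ^ (r + 1) * m)).toFinset with hZ
    have hXZ : X + X ⊆ Z := by
      intro z hz
      obtain ⟨x, hx, y, hy, rfl⟩ := Finset.mem_add.1 hz
      rw [hZ, Set.mem_toFinset]
      convert add_mem_sumsOfAtMost (Set.mem_toFinset.1 hx) (Set.mem_toFinset.1 hy) using 1
      ring_nf
    have h1 := Finset.ruzsa_triangle_inequality_sub_add_add X X X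
    rw [hX, hdiff, ← hX, Finset.card_univ] at h1
    have h2 : Fintype.card G * X.card ≤ Z.card ^ 2 := by
      rw [sq]
      exact h1.trans (Nat.mul_le_mul (Finset.card_le_card hXZ) (Finset.card_le_card hXZ))
    calc Fintype.card G ^ 2 ^ (r + 1 + 1)
        = Fintype.card G ^ 2 ^ (r + 1) * Fintype.card G ^ 2 ^ (r + 1) := by ring
      _ ≤ Fintype.card G ^ 2 ^ (r + 1) * (X.card ^ 2 ^ (r + 1) * Fintype.card G) :=
          Nat.mul_le_mul_left _ ih
      _ = (Fintype.card G * X.card) ^ 2 ^ (r + 1) * Fintype.card G := by ring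
      _ ≤ (Z.card ^ 2) ^ 2 ^ (r + 1) * Fintype.card G :=
          Nat.mul_le_mul_right _ (Nat.pow_le_pow_left h2 _)
      _ = _ := by ring

end field

/-- The number of elements of a multiplicative subgroup of order `t` that suffice to write every
element of a finite field with less than `t ^ (L + 1)` elements as their sum. -/
def sumLength (L : ℕ) : ℕ := 96 * ((L + 1) * 4 ^ L)

/-- A Waring type theorem in finite fields. -/
theorem mem_sumsOfAtMost_sumLength {K : Type*} [Field K] [Finite K] {A : Submonoid K}
    (hA : 0 ∉ A) (hgen : AddSubmonoid.closure (A : Set K) = ⊤) (hA2 : 2 ≤ Nat.card A) {L : ℕ}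
    (hL : Nat.card K < Nat.card A ^ (L + 1)) (z : K) :
    z ∈ sumsOfAtMost (A : Set K) (sumLength L) := by
  classical
  have := Fintype.ofFinite K
  have hcA : Nat.card A = (A : Set K).toFinset.card := by
    rw [Set.toFinset_card, ← Nat.card_eq_fintype_card]; rfl
  have hcK : Nat.card K = Fintype.card K := Nat.card_eq_fintype_card
  rw [hcA] at hA2
  rw [hcA, hcK] at hL
  have hA2' : ∃ a ∈ A, ∃ b ∈ A, a ≠ b := by
    obtain ⟨a, ha, b, hb, hab⟩ := Finset.one_lt_card.1 hA2
    exact ⟨a, Set.mem_toFinset.1 ha, b, Set.mem_toFinset.1 hb, hab⟩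
  have hdiff := diffSums_eq_univ hA (isDiffQuotient_growthLength hA2' hgen hL)
  set r := Nat.clog 2 (L + 1) with hr
  have hr1 : L + 1 ≤ 2 ^ r := Nat.le_pow_clog one_lt_two _
  have hr2 : 2 ^ r ≤ 2 * (L + 1) := by
    rcases Nat.eq_zero_or_pos L with rfl | hLpos
    · simp [hr]
    · have h1 : 2 ^ (r - 1) < L + 1 := Nat.pow_pred_clog_lt_self one_lt_two (by omega)
      have h2 : r ≠ 0 := (Nat.clog_pos one_lt_two (by omega)).ne'
      calc 2 ^ r = 2 ^ (r - 1) * 2 := by rw [← pow_succ, Nat.sub_add_cancel (by omega)]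
        _ ≤ 2 * (L + 1) := by omega
  have hpow := card_pow_le_card_sumsOfAtMost_pow hdiff r
  set X := (sumsOfAtMost (A : Set K) (2 ^ r * (12 * growthLength L))).toFinset with hX
  -- The stray factor `|K|` in `hpow` is at most `|A| ^ 2 ^ r`, so the `2 ^ r`-th root can be taken.
  have hcard : Fintype.card K ^ 2 ≤ X.card ^ 2 * (A : Set K).toFinset.card := by
    have h1 : Fintype.card K ≤ (A : Set K).toFinset.card ^ 2 ^ r :=
      hL.le.trans (Nat.pow_le_pow_right (by omega) hr1)
    have h2 := hpow.trans (Nat.mul_le_mul_left _ h1)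
    rw [pow_succ', pow_mul, pow_mul, ← mul_pow] at h2
    exact (Nat.pow_le_pow_iff_left (by positivity)).1 h2
  have hinv : ∀ a ∈ (A : Set K).toFinset, ∀ x ∈ X, a * x ∈ X := by
    intro a ha x hx
    rw [hX, Set.mem_toFinset] at hx ⊢
    rw [Set.mem_toFinset] at ha
    exact map_mem_sumsOfAtMost (AddMonoidHom.mulLeft a) (fun b hb => A.mul_mem ha hb) hx
  obtain ⟨x, hx, y, hy, x', hx', y', hy', rfl⟩ := exists_sum_four_eq X (A : Set K).toFinset
    (by simpa using hA) hinv ⟨0, Set.mem_toFinset.2 (zero_mem_sumsOfAtMost _ _)⟩ hcard z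
  rw [hX, Set.mem_toFinset] at hx hy hx' hy'
  refine sumsOfAtMost_mono ?_ (add_mem_sumsOfAtMost (add_mem_sumsOfAtMost hx hy)
    (add_mem_sumsOfAtMost hx' hy'))
  -- The length is `4 * 2 ^ r * 12 * growthLength L`, at most `4 * 2 * (L + 1) * 12 * 4 ^ L`.
  have h3 := Nat.mul_le_mul hr2 (growthLength_le L)
  rw [sumLength]
  nlinarith

/-! ### Separating maximal ideals by short sums -/

section ring

variable {R : Type*} [CommRing R] {A : Submonoid R}

lemma exists_mem_sumsOfAtMost_sub_mem [Finite R] (hunit : ∀ a ∈ A, IsUnit a)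
    (hgen : AddSubmonoid.closure (A : Set R) = ⊤) (J : Ideal R) [hJ : J.IsMaximal] {t L : ℕ}
    (ht : 2 ≤ t) (htA : t ≤ Nat.card (A.map (Ideal.Quotient.mk J)))
    (hL : Nat.card (R ⧸ J) < t ^ (L + 1)) (r : R) :
    ∃ x ∈ sumsOfAtMost (A : Set R) (sumLength L), r - x ∈ J := by
  let := Ideal.Quotient.field J
  have : Finite (R ⧸ J) := .of_surjective _ Ideal.Quotient.mk_surjective
  have hA0 : (0 : R ⧸ J) ∉ A.map (Ideal.Quotient.mk J) := by
    rintro ⟨a, ha, h0⟩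
    exact ((hunit a ha).map (Ideal.Quotient.mk J)).ne_zero h0
  have hclosure : AddSubmonoid.closure (A.map (Ideal.Quotient.mk J) : Set (R ⧸ J)) = ⊤ := by
    have h1 := AddMonoidHom.map_mclosure (Ideal.Quotient.mk J : R →+ R ⧸ J) (A : Set R)
    rw [hgen, ← AddMonoidHom.mrange_eq_map,
      AddMonoidHom.mrange_eq_top.2 (show Function.Surjective (Ideal.Quotient.mk J : R →+ R ⧸ J) from
        Ideal.Quotient.mk_surjective)] at h1
    exact h1.symm
  have h2 := mem_sumsOfAtMost_sumLength hA0 hclosure (ht.trans htA)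
    (hL.trans_le (Nat.pow_le_pow_left htA _)) (Ideal.Quotient.mk J r)
  obtain ⟨x, hx, hxr⟩ := exists_map_eq_of_mem_sumsOfAtMost
    (Ideal.Quotient.mk J : R →+ R ⧸ J) (S := (A : Set R)) h2
  exact ⟨x, hx, Ideal.Quotient.eq.1 hxr.symm⟩

/-- If short sums in `J` all lay in `I`, covering modulo `J` would extend to covering modulo `I ⊓
J`, by induction along the generators; applied to elements of `J` this forces `J ≤ I`. -/
lemma exists_mem_notMem_of_forall_exists_sub_mem
    (hgen : AddSubmonoid.closure (A : Set R) = ⊤) {I J : Ideal R} [hI : I.IsMaximal]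
    [hJ : J.IsMaximal] (hIJ : J ≠ I) {M : ℕ} (hM : 1 ≤ M)
    (hcov : ∀ r : R, ∃ x ∈ sumsOfAtMost (A : Set R) M, r - x ∈ J) :
    ∃ x ∈ sumsOfAtMost (A : Set R) (3 * M), x ∈ J ∧ x ∉ I := by
  by_contra! h
  refine hIJ (hJ.eq_of_le hI.ne_top fun r hr => ?_)
  have key : ∃ x ∈ sumsOfAtMost (A : Set R) M, r - x ∈ J ∧ r - x ∈ I := by
    clear hr
    have hmem : r ∈ AddSubmonoid.closure (A : Set R) := hgen ▸ AddSubmonoid.mem_top r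
    induction hmem using AddSubmonoid.closure_induction_right with
    | zero => exact ⟨0, zero_mem_sumsOfAtMost _ _, by simp, by simp⟩
    | add_right r _ a ha ih =>
      obtain ⟨x, hx, hxJ, hxI⟩ := ih
      -- The representative `y` of `-z` replaces subtraction: `z + y` and `y + x + a` are genuine
      -- sums in `J`, and they differ by `x + a - z`.
      obtain ⟨z, hz, hzJ⟩ := hcov (r + a)
      obtain ⟨y, hy, hyJ⟩ := hcov (-z)
      refine ⟨z, hz, hzJ, ?_⟩
      have h1 : z + y ∈ I := by
        refine h _ (sumsOfAtMost_mono (by omega) (add_mem_sumsOfAtMost hz hy)) ?_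
        have := J.neg_mem hyJ
        rwa [show -(-z - y) = z + y by ring] at this
      have h2 : y + x + a ∈ I := by
        refine h _ (sumsOfAtMost_mono (by omega) (add_mem_sumsOfAtMost
          (add_mem_sumsOfAtMost hy hx) (subset_sumsOfAtMost_one ha))) ?_
        have := J.sub_mem (J.sub_mem hzJ hyJ) hxJ
        rwa [show r + a - z - (-z - y) - (r - x) = y + x + a by ring] at this
      have := I.add_mem hxI (I.sub_mem h2 h1)
      rwa [show r - x + (y + x + a - (z + y)) = r + a - z by ring] at this
  obtain ⟨x, hx, hxJ, hxI⟩ := key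
  have h1 : x ∈ J := by simpa using J.sub_mem hr hxJ
  have h2 := h x (sumsOfAtMost_mono (by omega) hx) h1
  simpa using I.add_mem hxI h2

/-- By pigeonhole two elements of `A` agree modulo `J` but not modulo `I`; `-1 ∈ A` makes their
difference a sum. -/
lemma exists_mem_notMem_of_card_map_lt [Finite R] (hneg : -1 ∈ A) {I J : Ideal R}
    (hcard : Nat.card (A.map (Ideal.Quotient.mk J)) < Nat.card (A.map (Ideal.Quotient.mk I))) :
    ∃ x ∈ sumsOfAtMost (A : Set R) 2, x ∈ J ∧ x ∉ I := by
  by_contra! h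
  have h2 : ∀ a ∈ A, ∀ b ∈ A, a - b ∈ J → a - b ∈ I := by
    intro a ha b hb hab
    refine h _ ?_ hab
    rw [show a - b = a + -1 * b by ring]
    exact add_mem_sumsOfAtMost (subset_sumsOfAtMost_one ha)
      (subset_sumsOfAtMost_one (A.mul_mem hneg hb))
  refine hcard.not_ge ?_
  have : Finite (R ⧸ J) := .of_surjective _ Ideal.Quotient.mk_surjective
  choose f hf hfy using fun y : A.map (Ideal.Quotient.mk I) => y.2
  refine Nat.card_le_card_of_injective
    (fun y => (⟨Ideal.Quotient.mk J (f y), f y, hf y, rfl⟩ : A.map (Ideal.Quotient.mk J))) ?_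
  intro y z hyz
  have h3 := h2 _ (hf y) _ (hf z) (Ideal.Quotient.eq.1 (congrArg Subtype.val hyz))
  exact Subtype.ext (by rw [← hfy y, ← hfy z, Ideal.Quotient.eq.2 h3])

lemma one_le_sumLength (L : ℕ) : 1 ≤ sumLength L := by
  have : 0 < (L + 1) * 4 ^ L := by positivity
  rw [sumLength]
  omega

/-- The number of elements of a group of units that suffice to generate all multiples of some
element of a module with `k` simple summands. -/
def lineLength (k L : ℕ) : ℕ := (3 * sumLength L) ^ (k - 1) * sumLength L

/-- If `V` is annihilated by the intersection of the maximal ideals `J j`, then sums of few elements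
of a group `A` of units generating `R` act on some nonzero element of `R v` like all of `R`. -/
theorem exists_ne_zero_forall_exists_smul_eq [Finite R] {V : Type*} [AddCommGroup V] [Module R V]
    (hunit : ∀ a ∈ A, IsUnit a) (hgen : AddSubmonoid.closure (A : Set R) = ⊤) {k : ℕ}
    (J : Fin k → Ideal R) [hJ : ∀ j, (J j).IsMaximal] (i : Fin k) {t L : ℕ} (ht : 2 ≤ t)
    (hti : t ≤ Nat.card (A.map (Ideal.Quotient.mk (J i))))
    (htj : ∀ j, t ≤ Nat.card (A.map (Ideal.Quotient.mk (J j))) ∨ -1 ∈ A)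
    (hL : ∀ j, Nat.card (R ⧸ J j) < t ^ (L + 1)) (v : V)
    (hv : ∀ r, (∀ j, r ∈ J j) → r • v = 0) (hvi : ∀ r, r • v = 0 → r ∈ J i) :
    ∃ u : V, u ≠ 0 ∧
      ∀ r : R, ∃ y ∈ sumsOfAtMost (A : Set R) (lineLength k L), y • v = r • u := by
  classical
  set M := sumLength L with hM
  have hM1 : 1 ≤ M := one_le_sumLength L
  have hsep : ∀ j, J j ≠ J i → ∃ x ∈ sumsOfAtMost (A : Set R) (3 * M), x ∈ J j ∧ x ∉ J i := by
    intro j hj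
    by_cases hcard : t ≤ Nat.card (A.map (Ideal.Quotient.mk (J j)))
    · exact exists_mem_notMem_of_forall_exists_sub_mem hgen hj hM1
        (exists_mem_sumsOfAtMost_sub_mem hunit hgen (J j) ht hcard (hL j))
    · obtain ⟨x, hx, h⟩ := exists_mem_notMem_of_card_map_lt ((htj j).resolve_left hcard)
        ((not_le.1 hcard).trans_le hti)
      exact ⟨x, sumsOfAtMost_mono (by omega) hx, h⟩
  -- Isomorphic summands share an annihilator, so only indices with a different ideal are to be
  -- killed; `i` itself is excluded, whence at most `k - 1` factors.
  set s : Finset (Fin k) := Finset.univ.filter fun j => J j ≠ J i with hs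
  have hs1 : s.card ≤ k - 1 := by
    have : s ⊆ Finset.univ.erase i := fun j hj =>
      Finset.mem_erase.2 ⟨fun h => (Finset.mem_filter.1 hj).2 (h ▸ rfl), Finset.mem_univ _⟩
    simpa using Finset.card_le_card this
  choose! f hf hfJ hfI using hsep
  set x := ∏ j ∈ s, f j with hx
  have hxA : x ∈ sumsOfAtMost (A : Set R) ((3 * M) ^ (k - 1)) :=
    sumsOfAtMost_mono (Nat.pow_le_pow_right (by omega) hs1)
      (prod_mem_sumsOfAtMost s f fun j hj => hf j (Finset.mem_filter.1 hj).2)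
  have hxJ : ∀ j, J j ≠ J i → x ∈ J j := fun j hj =>
    (J j).mem_of_dvd (Finset.dvd_prod_of_mem f (Finset.mem_filter.2 ⟨Finset.mem_univ j, hj⟩))
      (hfJ j hj)
  have hxI : x ∉ J i := by
    intro h
    obtain ⟨j, hj, hjI⟩ := (Ideal.IsPrime.prod_mem_iff (hp := (hJ i).isPrime)).1 h
    exact hfI j (Finset.mem_filter.1 hj).2 hjI
  refine ⟨x • v, fun h => hxI (hvi x h), fun r => ?_⟩
  obtain ⟨c, hc, hrc⟩ := exists_mem_sumsOfAtMost_sub_mem hunit hgen (J i) ht hti (hL i) r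
  refine ⟨x * c, mul_mem_sumsOfAtMost hxA hc, ?_⟩
  have h0 : ((r - c) * x) • v = 0 := by
    refine hv _ fun j => ?_
    by_cases hj : J j = J i
    · exact hj ▸ (J i).mul_mem_right _ hrc
    · exact (J j).mul_mem_left _ (hxJ j hj)
  rw [sub_mul, sub_smul, sub_eq_zero] at h0
  rw [smul_smul, h0, mul_comm]

end ring

/-! ### Summands, their annihilators and residue fields -/

section representation

variable {p : ℕ} [Fact p.Prime] {V : Type*} [AddCommGroup V] [Module (ZMod p) V]
  {A H : Subgroup (V ≃ₗ[ZMod p] V)} {R : Type*} [CommRing R] [Module R V] {φ : A →* R}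

lemma smul_mem_subrepresentation (hφ : ∀ a v, φ a • v = (a : V ≃ₗ[ZMod p] V) v)
    (hgen : AddSubmonoid.closure (Set.range φ) = ⊤) (U : Subrepresentation (naturalRep A)) (r : R)
    {w : V} (hw : w ∈ U.toSubmodule) : r • w ∈ U.toSubmodule := by
  have hr : r ∈ AddSubmonoid.closure (Set.range φ) := hgen ▸ AddSubmonoid.mem_top r
  induction hr using AddSubmonoid.closure_induction with
  | mem x hx =>
    obtain ⟨a, rfl⟩ := hx
    rw [hφ]
    exact U.apply_mem_toSubmodule a hw
  | zero => rw [zero_smul]; exact U.toSubmodule.zero_mem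
  | add x y _ _ hx hy => rw [add_smul]; exact U.toSubmodule.add_mem hx hy

/-- A subrepresentation as a submodule over a ring generated by the group. -/
def Subrepresentation.toSubmoduleOfClosure (hφ : ∀ a v, φ a • v = (a : V ≃ₗ[ZMod p] V) v)
    (hgen : AddSubmonoid.closure (Set.range φ) = ⊤) (U : Subrepresentation (naturalRep A)) :
    Submodule R V where
  carrier := U.toSubmodule
  add_mem' := U.toSubmodule.add_mem
  zero_mem' := U.toSubmodule.zero_mem
  smul_mem' r _ hw := smul_mem_subrepresentation hφ hgen U r hw

lemma isSimpleModule_toSubmoduleOfClosure (hφ : ∀ a v, φ a • v = (a : V ≃ₗ[ZMod p] V) v)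
    (hgen : AddSubmonoid.closure (Set.range φ) = ⊤) (U : Subrepresentation (naturalRep A))
    (hU : U.toRepresentation.IsIrreducible) :
    IsSimpleModule R (U.toSubmoduleOfClosure hφ hgen) := by
  have hnt : Nontrivial (U.toSubmoduleOfClosure hφ hgen) := by
    obtain ⟨x, y, hxy⟩ := exists_pair_ne (Subrepresentation U.toRepresentation)
    by_contra hs
    rw [not_nontrivial_iff_subsingleton] at hs
    refine hxy (Subrepresentation.toSubmodule_injective (Submodule.ext fun w => ?_))
    have : w = 0 := hs.elim w 0
    simp [this]
  refine (isSimpleModule_iff R _).2 { exists_pair_ne := ⟨⊥, ⊤, bot_ne_top⟩, eq_bot_or_eq_top := ?_ }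
  intro N
  let N' : Subrepresentation U.toRepresentation :=
    { toSubmodule :=
        { carrier := {w | (⟨w.1, w.2⟩ : U.toSubmoduleOfClosure hφ hgen) ∈ N}
          add_mem' := fun h h' => N.add_mem h h'
          zero_mem' := N.zero_mem
          smul_mem' := fun c w hw => by
            -- Scalars of the prime field act as integers, so an `R`-submodule is automatically a
            -- subspace.
            obtain ⟨n, rfl⟩ := ZMod.intCast_surjective c
            have h1 : (⟨((n : ZMod p) • w).1, ((n : ZMod p) • w).2⟩ : U.toSubmoduleOfClosure hφ hgen) =
                n • ⟨w.1, w.2⟩ :=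
              Subtype.ext (Int.cast_smul_eq_zsmul (ZMod p) n w.1)
            have h2 := N.toAddSubgroup.zsmul_mem hw n
            exact (congrArg (· ∈ N) h1).mpr h2 }
      apply_mem_toSubmodule := fun a w hw => by
        have h1 : (⟨(U.toRepresentation a w).1, (U.toRepresentation a w).2⟩ :
            U.toSubmoduleOfClosure hφ hgen) = φ a • ⟨w.1, w.2⟩ :=
          Subtype.ext (hφ a w.1).symm
        exact (congrArg (· ∈ N) h1).mpr (N.smul_mem (φ a) hw) }
  rcases hU.eq_bot_or_eq_top N' with h | h
  · left
    refine (Submodule.eq_bot_iff N).2 fun w hw => ?_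
    have : (⟨w.1, w.2⟩ : U.toSubmodule) ∈ N'.toSubmodule := hw
    rw [h] at this
    exact Subtype.ext (congrArg Subtype.val ((Submodule.mem_bot _).1 this))
  · right
    refine Submodule.eq_top_iff'.2 fun w => ?_
    have : (⟨w.1, w.2⟩ : U.toSubmodule) ∈ N'.toSubmodule := by
      rw [h]; exact Submodule.mem_top
    exact this

variable {k : ℕ} {W : Fin k → Subrepresentation (naturalRep A)}

/-- The annihilator of a subrepresentation in a ring generated by the group. -/
def annihilatorOfClosure (hφ : ∀ a v, φ a • v = (a : V ≃ₗ[ZMod p] V) v)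
    (hgen : AddSubmonoid.closure (Set.range φ) = ⊤) (U : Subrepresentation (naturalRep A)) :
    Ideal R :=
  Module.annihilator R (U.toSubmoduleOfClosure hφ hgen)

lemma mem_annihilatorOfClosure {hφ : ∀ a v, φ a • v = (a : V ≃ₗ[ZMod p] V) v}
    {hgen : AddSubmonoid.closure (Set.range φ) = ⊤} {U : Subrepresentation (naturalRep A)} {r : R} :
    r ∈ annihilatorOfClosure hφ hgen U ↔ ∀ w ∈ U.toSubmodule, r • w = 0 := by
  rw [annihilatorOfClosure, Module.mem_annihilator]
  exact ⟨fun h w hw => congrArg Subtype.val (h ⟨w, hw⟩), fun h w => Subtype.ext (h w.1 w.2)⟩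

lemma isMaximal_annihilatorOfClosure (hφ : ∀ a v, φ a • v = (a : V ≃ₗ[ZMod p] V) v)
    (hgen : AddSubmonoid.closure (Set.range φ) = ⊤)
    (hW : IsIrreducibleDecomposition (naturalRep A) W) (j : Fin k) :
    (annihilatorOfClosure hφ hgen (W j)).IsMaximal := by
  have := isSimpleModule_toSubmoduleOfClosure hφ hgen (W j) (hW.2 j)
  exact IsSimpleModule.annihilator_isMaximal

lemma smul_eq_zero_of_forall_mem_annihilator (hφ : ∀ a v, φ a • v = (a : V ≃ₗ[ZMod p] V) v)
    (hgen : AddSubmonoid.closure (Set.range φ) = ⊤)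
    (hW : IsIrreducibleDecomposition (naturalRep A) W) (v : V) (r : R)
    (hr : ∀ j, r ∈ annihilatorOfClosure hφ hgen (W j)) : r • v = 0 := by
  have hv : v ∈ ⨆ j, (W j).toSubmodule := by
    rw [hW.1.submodule_iSup_eq_top]; exact Submodule.mem_top
  induction hv using Submodule.iSup_induction' with
  | mem j w hw => exact mem_annihilatorOfClosure.1 (hr j) w hw
  | zero => exact smul_zero r
  | add x y _ _ hx hy => rw [smul_add, hx, hy, add_zero]

/-- The sum of all summands but one. -/
def complementSubmodule (W : Fin k → Subrepresentation (naturalRep A)) (i : Fin k) :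
    Submodule (ZMod p) V :=
  ⨆ j, ⨆ _ : j ≠ i, (W j).toSubmodule

lemma disjoint_complementSubmodule (hW : IsIrreducibleDecomposition (naturalRep A) W) (i : Fin k) :
    Disjoint (W i).toSubmodule (complementSubmodule W i) :=
  hW.1.submodule_iSupIndep i

lemma sup_complementSubmodule (hW : IsIrreducibleDecomposition (naturalRep A) W) (i : Fin k) :
    (W i).toSubmodule ⊔ complementSubmodule W i = ⊤ := by
  refine top_unique ?_
  rw [← hW.1.submodule_iSup_eq_top]
  refine iSup_le fun j => ?_
  by_cases hj : j = i
  · exact hj ▸ le_sup_left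
  · exact le_sup_of_le_right (le_iSup₂_of_le j hj le_rfl)

lemma smul_mem_complementSubmodule (hφ : ∀ a v, φ a • v = (a : V ≃ₗ[ZMod p] V) v)
    (hgen : AddSubmonoid.closure (Set.range φ) = ⊤) (i : Fin k) (r : R) {v : V}
    (hv : v ∈ complementSubmodule W i) : r • v ∈ complementSubmodule W i := by
  let N : Subrepresentation (naturalRep A) :=
    { toSubmodule := complementSubmodule W i
      apply_mem_toSubmodule := fun a w hw => by
        have : complementSubmodule W i ≤ (complementSubmodule W i).comap (naturalRep A a) :=
          iSup₂_le fun j hj x hx => (le_iSup₂_of_le (f := fun j (_ : j ≠ i) => (W j).toSubmodule)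
            j hj le_rfl) ((W j).apply_mem_toSubmodule a hx)
        exact this hw }
  exact smul_mem_subrepresentation hφ hgen N r hv

lemma exists_ne_zero_mem_summand (hW : IsIrreducibleDecomposition (naturalRep A) W) (i : Fin k) :
    ∃ w ∈ (W i).toSubmodule, w ≠ 0 := by
  by_contra! h
  have h' := hW.2 i
  obtain ⟨x, y, hxy⟩ := exists_pair_ne (Subrepresentation (W i).toRepresentation)
  refine hxy (Subrepresentation.toSubmodule_injective (Submodule.ext fun w => ?_))
  have : w = 0 := Subtype.ext (h w.1 w.2)
  simp [this]

/-- Otherwise `r' * r + s = 1` with `s` killing `W i`, so `v = s • v` has no component in `W i`. -/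
lemma mem_annihilator_of_smul_eq_zero (hφ : ∀ a v, φ a • v = (a : V ≃ₗ[ZMod p] V) v)
    (hgen : AddSubmonoid.closure (Set.range φ) = ⊤)
    (hW : IsIrreducibleDecomposition (naturalRep A) W) {i : Fin k} {v : V}
    (hv : v ∉ complementSubmodule W i) {r : R} (hr : r • v = 0) :
    r ∈ annihilatorOfClosure hφ hgen (W i) := by
  have hmax := isMaximal_annihilatorOfClosure hφ hgen hW i
  by_contra hri
  obtain ⟨r', s, hs, hrs⟩ := Ideal.IsMaximal.exists_inv hmax hri
  refine hv ?_
  have hsv : s • v = v := by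
    calc s • v = (r' * r + s) • v := by rw [add_smul, mul_smul, hr, smul_zero, zero_add]
      _ = v := by rw [hrs, one_smul]
  obtain ⟨x, hx, y, hy, rfl⟩ := Submodule.mem_sup.1
    (sup_complementSubmodule hW i ▸ Submodule.mem_top (x := v))
  rw [← hsv, smul_add, mem_annihilatorOfClosure.1 hs x hx, zero_add]
  exact smul_mem_complementSubmodule hφ hgen i s hy

lemma notMem_complementSubmodule (hW : IsIrreducibleDecomposition (naturalRep A) W) {i : Fin k}
    {w : V} (hw : w ∈ (W i).toSubmodule) (hw0 : w ≠ 0) : w ∉ complementSubmodule W i := fun h =>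
  hw0 ((Submodule.disjoint_def.1 (disjoint_complementSubmodule hW i)) w hw h)

/-- An orbit of an irreducible group spans. -/
lemma span_eq_top_of_isIrreducible (hH : (naturalRep H).IsIrreducible) {S : Set V}
    (hS : ∀ h ∈ H, ∀ s ∈ S, h s ∈ S) {v : V} (hv : v ∈ S) (hv0 : v ≠ 0) :
    Submodule.span (ZMod p) S = ⊤ := by
  let N : Subrepresentation (naturalRep H) :=
    { toSubmodule := Submodule.span (ZMod p) S
      apply_mem_toSubmodule := fun h w hw => by
        have : Submodule.span (ZMod p) S ≤
            (Submodule.span (ZMod p) S).comap (naturalRep H h) :=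
          Submodule.span_le.2 fun s hs => Submodule.subset_span (hS h h.2 s hs)
        exact this hw }
  rcases hH.eq_bot_or_eq_top N with h | h
  · have : v ∈ N.toSubmodule := Submodule.subset_span hv
    rw [h] at this
    exact absurd ((Submodule.mem_bot _).1 this) hv0
  · exact congrArg Subrepresentation.toSubmodule h

lemma exists_apply_notMem_complementSubmodule (hH : (naturalRep H).IsIrreducible)
    (hW : IsIrreducibleDecomposition (naturalRep A) W) (i : Fin k) {v : V} (hv0 : v ≠ 0) :
    ∃ h ∈ H, h v ∉ complementSubmodule W i := by
  by_contra! hcon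
  have hspan := span_eq_top_of_isIrreducible hH (S := {x | ∃ h ∈ H, h v = x}) (v := v)
    (by rintro g hg _ ⟨h, hh, rfl⟩; exact ⟨g * h, H.mul_mem hg hh, rfl⟩)
    ⟨1, H.one_mem, rfl⟩ hv0
  obtain ⟨w, hw, hw0⟩ := exists_ne_zero_mem_summand hW i
  refine notMem_complementSubmodule hW hw hw0 ?_
  have : Submodule.span (ZMod p) {x | ∃ h ∈ H, h v = x} ≤ complementSubmodule W i :=
    Submodule.span_le.2 (by rintro _ ⟨h, hh, rfl⟩; exact hcon h hh)
  exact this (hspan ▸ Submodule.mem_top)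

/-- For a nonzero `w` in the summand, the map `r ↦ r • w` is injective modulo the annihilator. -/
lemma card_quotient_annihilator_le [Finite V]
    (hφ : ∀ a v, φ a • v = (a : V ≃ₗ[ZMod p] V) v)
    (hgen : AddSubmonoid.closure (Set.range φ) = ⊤)
    (hW : IsIrreducibleDecomposition (naturalRep A) W) (i : Fin k) :
    Nat.card (R ⧸ annihilatorOfClosure hφ hgen (W i)) ≤ Nat.card (W i).toSubmodule := by
  obtain ⟨w, hw, hw0⟩ := exists_ne_zero_mem_summand hW i
  choose f hf using Ideal.Quotient.mk_surjective (I := annihilatorOfClosure hφ hgen (W i))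
  refine Nat.card_le_card_of_injective
    (fun y => (⟨f y • w, smul_mem_subrepresentation hφ hgen (W i) _ hw⟩ : (W i).toSubmodule)) ?_
  intro y z hyz
  have h1 : f y • w = f z • w := congrArg Subtype.val hyz
  rw [← hf y, ← hf z, Ideal.Quotient.eq]
  refine mem_annihilator_of_smul_eq_zero hφ hgen hW (notMem_complementSubmodule hW hw hw0) ?_
  rw [sub_smul, h1, sub_self]

lemma prod_card_summand (hW : IsIrreducibleDecomposition (naturalRep A) W) :
    ∏ i, Nat.card (W i).toSubmodule = Nat.card V := by
  rw [← Nat.card_pi]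
  exact Nat.card_congr ((DirectSum.addEquivProd fun i => (W i).toSubmodule).symm.toEquiv.trans
    (Equiv.ofBijective _ hW.1))

/-- The image of a group of units in a residue field. -/
def imageSubmonoid (φ : A →* R) (J : Ideal R) : Submonoid (R ⧸ J) :=
  (MonoidHom.mrange φ).map (Ideal.Quotient.mk J)

/-- `A` acts faithfully, and an element acting trivially on every summand is trivial. -/
lemma card_le_prod_card_imageSubmonoid [Finite R]
    (hφ : ∀ a v, φ a • v = (a : V ≃ₗ[ZMod p] V) v)
    (hgen : AddSubmonoid.closure (Set.range φ) = ⊤)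
    (hW : IsIrreducibleDecomposition (naturalRep A) W) :
    Nat.card A ≤ ∏ i, Nat.card (imageSubmonoid φ (annihilatorOfClosure hφ hgen (W i))) := by
  have (J : Ideal R) : Finite (R ⧸ J) := .of_surjective _ Ideal.Quotient.mk_surjective
  rw [← Nat.card_pi]
  refine Nat.card_le_card_of_injective
    (fun a i => ⟨Ideal.Quotient.mk _ (φ a), φ a, ⟨a, rfl⟩, rfl⟩) ?_
  intro a b hab
  refine Subtype.ext (LinearEquiv.ext fun v => ?_)
  rw [← hφ, ← hφ, ← sub_eq_zero, ← sub_smul]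
  refine smul_eq_zero_of_forall_mem_annihilator hφ hgen hW v _ fun j => ?_
  exact Ideal.Quotient.eq.1 (congrArg Subtype.val (congrFun hab j))

/-- Conjugation by `h` preserves the operators coming from `R`: `r'` acts as `h⁻¹ r h`. -/
lemma exists_conj_smul (hφ : ∀ a v, φ a • v = (a : V ≃ₗ[ZMod p] V) v)
    (hgen : AddSubmonoid.closure (Set.range φ) = ⊤) {h : V ≃ₗ[ZMod p] V}
    (hconj : ∀ a ∈ A, h⁻¹ * a * h ∈ A) (r : R) : ∃ r' : R, ∀ v, h (r' • v) = r • h v := by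
  have hr : r ∈ AddSubmonoid.closure (Set.range φ) := hgen ▸ AddSubmonoid.mem_top r
  induction hr using AddSubmonoid.closure_induction with
  | mem x hx =>
    obtain ⟨a, rfl⟩ := hx
    refine ⟨φ ⟨_, hconj a a.2⟩, fun v => ?_⟩
    rw [hφ, hφ]
    change h (h.symm (a.1 (h v))) = _
    rw [LinearEquiv.apply_symm_apply]
  | zero => exact ⟨0, fun v => by simp⟩
  | add x y _ _ hx hy =>
    obtain ⟨x', hx⟩ := hx
    obtain ⟨y', hy⟩ := hy
    exact ⟨x' + y', fun v => by rw [add_smul, map_add, hx, hy, add_smul]⟩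

/-- Irreducibility of `H` supplies `h` moving some `w ∈ W i` to a vector with nonzero component in
`W j`. If `r'` kills `w`, its conjugate `r` kills `h w`, hence lies in the annihilator of `W j`.
With `i` and `j` exchanged, this makes residue fields and images of `A` equal in size. -/
lemma exists_forall_mem_annihilator_of_normal (hH : (naturalRep H).IsIrreducible)
    (hnorm : ∀ h ∈ H, ∀ a ∈ A, h * a * h⁻¹ ∈ A)
    (hφ : ∀ a v, φ a • v = (a : V ≃ₗ[ZMod p] V) v)
    (hgen : AddSubmonoid.closure (Set.range φ) = ⊤)
    (hW : IsIrreducibleDecomposition (naturalRep A) W) (i j : Fin k) :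
    ∃ h : V ≃ₗ[ZMod p] V, (∀ a ∈ A, h⁻¹ * a * h ∈ A) ∧ ∀ r r' : R, (∀ v, h (r' • v) = r • h v) →
      r' ∈ annihilatorOfClosure hφ hgen (W i) → r ∈ annihilatorOfClosure hφ hgen (W j) := by
  obtain ⟨w, hw, hw0⟩ := exists_ne_zero_mem_summand hW i
  obtain ⟨h, hh, hhw⟩ := exists_apply_notMem_complementSubmodule hH hW j hw0
  refine ⟨h, fun a ha => ?_, fun r r' hr hr' => ?_⟩
  · have := hnorm h⁻¹ (H.inv_mem hh) a ha
    rwa [inv_inv] at this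
  · refine mem_annihilator_of_smul_eq_zero hφ hgen hW hhw ?_
    rw [← hr, mem_annihilatorOfClosure.1 hr' w hw, map_zero]

lemma card_quotient_annihilator_le_of_normal [Finite R] (hH : (naturalRep H).IsIrreducible)
    (hnorm : ∀ h ∈ H, ∀ a ∈ A, h * a * h⁻¹ ∈ A)
    (hφ : ∀ a v, φ a • v = (a : V ≃ₗ[ZMod p] V) v)
    (hgen : AddSubmonoid.closure (Set.range φ) = ⊤)
    (hW : IsIrreducibleDecomposition (naturalRep A) W) (i j : Fin k) :
    Nat.card (R ⧸ annihilatorOfClosure hφ hgen (W j)) ≤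
      Nat.card (R ⧸ annihilatorOfClosure hφ hgen (W i)) := by
  have (J : Ideal R) : Finite (R ⧸ J) := .of_surjective _ Ideal.Quotient.mk_surjective
  obtain ⟨h, hconj, hann⟩ := exists_forall_mem_annihilator_of_normal hH hnorm hφ hgen hW i j
  choose f hf using Ideal.Quotient.mk_surjective (I := annihilatorOfClosure hφ hgen (W j))
  choose c hc using exists_conj_smul hφ hgen hconj
  refine Nat.card_le_card_of_injective
    (fun y => Ideal.Quotient.mk (annihilatorOfClosure hφ hgen (W i)) (c (f y))) fun y z hyz => ?_
  rw [← hf y, ← hf z, Ideal.Quotient.eq]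
  refine hann _ (c (f y) - c (f z)) (fun v => ?_) (Ideal.Quotient.eq.1 hyz)
  rw [sub_smul, map_sub, hc, hc, sub_smul]

lemma card_imageSubmonoid_le_of_normal [Finite R] (hH : (naturalRep H).IsIrreducible)
    (hnorm : ∀ h ∈ H, ∀ a ∈ A, h * a * h⁻¹ ∈ A)
    (hφ : ∀ a v, φ a • v = (a : V ≃ₗ[ZMod p] V) v)
    (hgen : AddSubmonoid.closure (Set.range φ) = ⊤)
    (hW : IsIrreducibleDecomposition (naturalRep A) W) (i j : Fin k) :
    Nat.card (imageSubmonoid φ (annihilatorOfClosure hφ hgen (W j))) ≤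
      Nat.card (imageSubmonoid φ (annihilatorOfClosure hφ hgen (W i))) := by
  have (J : Ideal R) : Finite (R ⧸ J) := .of_surjective _ Ideal.Quotient.mk_surjective
  obtain ⟨h, hconj, hann⟩ := exists_forall_mem_annihilator_of_normal hH hnorm hφ hgen hW i j
  have hex : ∀ y : imageSubmonoid φ (annihilatorOfClosure hφ hgen (W j)),
      ∃ a : A, Ideal.Quotient.mk _ (φ a) = y.1 := by
    rintro ⟨_, _, ⟨a, rfl⟩, rfl⟩
    exact ⟨a, rfl⟩
  choose f hf using hex
  have hc : ∀ a : A, ∀ v, h (φ ⟨_, hconj a a.2⟩ • v) = φ a • h v := by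
    intro a v
    rw [hφ, hφ]
    change h (h.symm (a.1 (h v))) = _
    rw [LinearEquiv.apply_symm_apply]
  refine Nat.card_le_card_of_injective
    (fun y => (⟨Ideal.Quotient.mk _ (φ ⟨_, hconj (f y) (f y).2⟩), _, ⟨_, rfl⟩, rfl⟩ :
      imageSubmonoid φ (annihilatorOfClosure hφ hgen (W i)))) fun y z hyz => ?_
  refine Subtype.ext ?_
  rw [← hf y, ← hf z, Ideal.Quotient.eq]
  refine hann _ (φ ⟨_, hconj (f y) (f y).2⟩ - φ ⟨_, hconj (f z) (f z).2⟩) (fun v => ?_)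
    (Ideal.Quotient.eq.1 (congrArg Subtype.val hyz))
  rw [sub_smul, map_sub, hc, hc, sub_smul]

end representation

/-! ### From a line to the whole space -/

section filling

variable {p : ℕ} [Fact p.Prime] {V : Type*} [AddCommGroup V] [Module (ZMod p) V]
  {A H : Subgroup (V ≃ₗ[ZMod p] V)}

lemma finset_sum_mem_sumsOfAtMost {M ι : Type*} [AddCommMonoid M] {S : Set M} (s : Finset ι)
    (f : ι → M) {n : ℕ} (hf : ∀ i ∈ s, f i ∈ sumsOfAtMost S n) :
    ∑ i ∈ s, f i ∈ sumsOfAtMost S (s.card * n) := by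
  have := multiset_sum_mem_sumsOfAtMost (s.val.map f) (S := S) (n := n) fun y hy => by
    obtain ⟨i, hi, rfl⟩ := Multiset.mem_map.1 hy
    exact hf i hi
  rwa [Multiset.card_map] at this

/-- If sums of few elements of an invariant set contain a line, then slightly longer sums fill the
whole space. -/
lemma mem_sumsOfAtMost_finrank_mul [Module.Finite (ZMod p) V] (hH : (naturalRep H).IsIrreducible)
    {S : Set V} (hS : ∀ h ∈ H, ∀ s ∈ S, h s ∈ S) {n : ℕ} {u : V} (hu0 : u ≠ 0)
    (hu : ∀ c : ZMod p, c • u ∈ sumsOfAtMost S n) (z : V) :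
    z ∈ sumsOfAtMost S (Module.finrank (ZMod p) V * n) := by
  have hspan := span_eq_top_of_isIrreducible hH (S := {x | ∃ h ∈ H, h u = x}) (v := u)
    (by rintro g hg _ ⟨h, hh, rfl⟩; exact ⟨g * h, H.mul_mem hg hh, rfl⟩)
    ⟨1, H.one_mem, rfl⟩ hu0
  obtain ⟨f, hf, hfs, -⟩ :=
    Submodule.exists_fun_fin_finrank_span_eq (ZMod p) {x | ∃ h ∈ H, h u = x}
  have hz : z ∈ Submodule.span (ZMod p) (Set.range f) := by
    rw [hfs, hspan]; exact Submodule.mem_top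
  obtain ⟨c, rfl⟩ := (Submodule.mem_span_range_iff_exists_fun (ZMod p)).1 hz
  have := finset_sum_mem_sumsOfAtMost (S := S) (n := n) Finset.univ (fun i => c i • f i)
    fun i _ => by
      obtain ⟨h, hh, hhu⟩ := hf i
      rw [← hhu, ← map_smul]
      exact map_mem_sumsOfAtMost (h : V →+ V) (fun s hs => hS h hh s hs) (hu (c i))
  refine sumsOfAtMost_mono (Nat.mul_le_mul_right _ ?_) this
  rw [Finset.card_univ, Fintype.card_fin]
  exact Submodule.finrank_le _

variable {R : Type*} [CommRing R] [Module R V] {φ : A →* R}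
  {k : ℕ} {W : Fin k → Subrepresentation (naturalRep A)}

/-- Common core of both bounds: `B` is the image of `A` in the directed case, and that image
together with its negatives in the undirected case. -/
lemma mem_sumsOfAtMost_of_card_bounds [Module.Finite (ZMod p) V] [Finite R]
    (hH : (naturalRep H).IsIrreducible)
    (hφ : ∀ a v, φ a • v = (a : V ≃ₗ[ZMod p] V) v)
    (hgen : AddSubmonoid.closure (Set.range φ) = ⊤)
    (hW : IsIrreducibleDecomposition (naturalRep A) W) {B : Submonoid R}
    (hB : ∀ b ∈ B, IsUnit b) (hφB : ∀ a, φ a ∈ B) (i : Fin k) {t L : ℕ} (ht : 2 ≤ t)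
    (hti : t ≤ Nat.card (imageSubmonoid φ (annihilatorOfClosure hφ hgen (W i))))
    (htj : ∀ j, t ≤ Nat.card (imageSubmonoid φ (annihilatorOfClosure hφ hgen (W j))) ∨ -1 ∈ B)
    (hL : ∀ j, Nat.card (R ⧸ annihilatorOfClosure hφ hgen (W j)) < t ^ (L + 1))
    {S : Set V} (hS : ∀ h ∈ H, ∀ s ∈ S, h s ∈ S) (hSB : ∀ b ∈ B, ∀ s ∈ S, b • s ∈ S)
    {v : V} (hv : v ∈ S) (hv0 : v ≠ 0) (z : V) :
    z ∈ sumsOfAtMost S (Module.finrank (ZMod p) V * lineLength k L) := by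
  have (J : Ideal R) : Finite (R ⧸ J) := .of_surjective _ Ideal.Quotient.mk_surjective
  obtain ⟨h, hh, hhv⟩ := exists_apply_notMem_complementSubmodule hH hW i hv0
  have hmax := fun j => isMaximal_annihilatorOfClosure hφ hgen hW j
  have hle : ∀ J : Ideal R, Nat.card (imageSubmonoid φ J) ≤
      Nat.card (B.map (Ideal.Quotient.mk J)) := by
    intro J
    refine Nat.card_mono (Set.toFinite _) ?_
    rintro _ ⟨_, ⟨a, rfl⟩, rfl⟩
    exact ⟨φ a, hφB a, rfl⟩
  have hgenB : AddSubmonoid.closure (B : Set R) = ⊤ :=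
    top_unique (hgen ▸ AddSubmonoid.closure_mono (by rintro _ ⟨a, rfl⟩; exact hφB a))
  obtain ⟨u, hu0, hu⟩ := exists_ne_zero_forall_exists_smul_eq hB hgenB
    (fun j => annihilatorOfClosure hφ hgen (W j)) i ht (hti.trans (hle _))
    (fun j => (htj j).imp_left fun h => h.trans (hle _)) hL (h v)
    (fun r hr => smul_eq_zero_of_forall_mem_annihilator hφ hgen hW (h v) r hr)
    (fun r hr => mem_annihilator_of_smul_eq_zero hφ hgen hW hhv hr)
  refine mem_sumsOfAtMost_finrank_mul hH hS hu0 (fun c => ?_) z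
  -- Scalars are integers, hence elements of `R`, so the line through `u` is covered.
  obtain ⟨n, rfl⟩ := ZMod.intCast_surjective c
  obtain ⟨y, hy, hyv⟩ := hu n
  rw [Int.cast_smul_eq_zsmul, ← Int.cast_smul_eq_zsmul R, ← hyv]
  exact map_mem_sumsOfAtMost ((AddMonoidHom.flip (smulAddHom R V)) (h v))
    (fun b hb => hSB b hb _ (hS h hh v hv)) hy

lemma card_pow_le_of_le {a t k q L : ℕ} (ha : a ≤ t ^ k) (hL : t ^ L ≤ q) : a ^ L ≤ q ^ k :=
  calc a ^ L ≤ (t ^ k) ^ L := Nat.pow_le_pow_left ha L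
    _ = (t ^ L) ^ k := by rw [← pow_mul, ← pow_mul, mul_comm]
    _ ≤ q ^ k := Nat.pow_le_pow_left hL k

/-- Sums of few elements of a symmetric invariant set fill the space. -/
theorem exists_forall_mem_sumsOfAtMost_of_neg_mem [Module.Finite (ZMod p) V] [Finite R]
    (hH : (naturalRep H).IsIrreducible) (hAH : A ≤ H) (hA : 1 < Nat.card A)
    (hφ : ∀ a v, φ a • v = (a : V ≃ₗ[ZMod p] V) v)
    (hgen : AddSubmonoid.closure (Set.range φ) = ⊤)
    (hW : IsIrreducibleDecomposition (naturalRep A) W) :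
    ∃ L, Nat.card A ^ L ≤ Nat.card V ^ k ∧
      ∀ S : Set V, (∀ h ∈ H, ∀ s ∈ S, h s ∈ S) → (∀ s ∈ S, -s ∈ S) → ∀ v ∈ S, v ≠ 0 →
        ∀ z, z ∈ sumsOfAtMost S (Module.finrank (ZMod p) V * lineLength k L) := by
  have : Finite V := Module.finite_of_finite (ZMod p)
  have hprod := card_le_prod_card_imageSubmonoid hφ hgen hW
  have hk : Nonempty (Fin k) := by
    by_contra hk
    rw [not_nonempty_iff] at hk
    rw [Finset.prod_of_isEmpty] at hprod
    omega
  obtain ⟨i, hi⟩ := Finite.exists_max fun i =>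
    Nat.card (imageSubmonoid φ (annihilatorOfClosure hφ hgen (W i)))
  set t := Nat.card (imageSubmonoid φ (annihilatorOfClosure hφ hgen (W i))) with ht
  have hAt : Nat.card A ≤ t ^ k := by
    simpa using hprod.trans (Finset.prod_le_pow_card Finset.univ _ t fun j _ => hi j)
  have ht2 : 2 ≤ t := by
    by_contra! h
    have : t ^ k ≤ 1 := pow_le_one₀ (Nat.zero_le _) (by omega)
    omega
  -- The largest `L` with `t ^ L ≤ |V|`; maximality gives `|R ⧸ J j| ≤ |V| < t ^ (L + 1)`.
  refine ⟨Nat.log t (Nat.card V),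
    card_pow_le_of_le hAt (Nat.pow_log_le_self t Nat.card_pos.ne'), ?_⟩
  intro S hS hSneg v hv hv0 z
  let B : Submonoid R :=
    { carrier := {r | ∃ a, r = φ a ∨ r = -φ a}
      one_mem' := ⟨1, Or.inl (map_one φ).symm⟩
      mul_mem' := by
        rintro _ _ ⟨a, rfl | rfl⟩ ⟨b, rfl | rfl⟩ <;> refine ⟨a * b, ?_⟩ <;> simp }
  refine mem_sumsOfAtMost_of_card_bounds hH hφ hgen hW (B := B) ?_ (fun a => ⟨a, Or.inl rfl⟩) i ht2
    le_rfl (fun j => Or.inr ⟨1, Or.inr (by rw [map_one])⟩) (fun j => ?_) hS ?_ hv hv0 z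
  · rintro _ ⟨a, rfl | rfl⟩
    · exact (Group.isUnit a).map φ
    · exact ((Group.isUnit a).map φ).neg
  · refine ((card_quotient_annihilator_le hφ hgen hW j).trans ?_).trans_lt
      (Nat.lt_pow_succ_log_self (by omega) _)
    exact Nat.card_le_card_of_injective _ Subtype.val_injective
  · rintro _ ⟨a, rfl | rfl⟩ s hs
    · rw [hφ]
      exact hS a (hAH a.2) s hs
    · rw [neg_smul, hφ]
      exact hSneg _ (hS a (hAH a.2) s hs)

/-- Sums of few elements of an invariant set fill the space, if the abelian subgroup is normal. -/
theorem exists_forall_mem_sumsOfAtMost_of_normal [Module.Finite (ZMod p) V] [Finite R]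
    (hH : (naturalRep H).IsIrreducible) (hAH : A ≤ H) (hA : 1 < Nat.card A)
    (hnorm : ∀ h ∈ H, ∀ a ∈ A, h * a * h⁻¹ ∈ A)
    (hφ : ∀ a v, φ a • v = (a : V ≃ₗ[ZMod p] V) v)
    (hgen : AddSubmonoid.closure (Set.range φ) = ⊤)
    (hW : IsIrreducibleDecomposition (naturalRep A) W) :
    ∃ L, Nat.card A ^ L ≤ Nat.card V ∧
      ∀ S : Set V, (∀ h ∈ H, ∀ s ∈ S, h s ∈ S) → ∀ v ∈ S, v ≠ 0 →
        ∀ z, z ∈ sumsOfAtMost S (Module.finrank (ZMod p) V * lineLength k L) := by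
  have : Finite V := Module.finite_of_finite (ZMod p)
  have (J : Ideal R) : Finite (R ⧸ J) := .of_surjective _ Ideal.Quotient.mk_surjective
  have hprod := card_le_prod_card_imageSubmonoid hφ hgen hW
  obtain ⟨i⟩ : Nonempty (Fin k) := by
    by_contra hk
    rw [not_nonempty_iff] at hk
    rw [Finset.prod_of_isEmpty] at hprod
    omega
  have hi := fun j => card_imageSubmonoid_le_of_normal hH hnorm hφ hgen hW i j
  have hi' := fun j => card_imageSubmonoid_le_of_normal hH hnorm hφ hgen hW j i
  set t := Nat.card (imageSubmonoid φ (annihilatorOfClosure hφ hgen (W i))) with ht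
  have hAt : Nat.card A ≤ t ^ k := by
    simpa using hprod.trans (Finset.prod_le_pow_card Finset.univ _ t fun j _ => hi j)
  have ht2 : 2 ≤ t := by
    by_contra! h
    have : t ^ k ≤ 1 := pow_le_one₀ (Nat.zero_le _) (by omega)
    omega
  set q := Nat.card (R ⧸ annihilatorOfClosure hφ hgen (W i)) with hq
  -- The residue fields have equal order, and each is no larger than its summand. This replaces the
  -- crude bound `q ≤ |V|`.
  have hqV : q ^ k ≤ Nat.card V := by
    rw [← prod_card_summand hW]
    calc q ^ k = ∏ _j : Fin k, q := by simp
      _ ≤ _ := Finset.prod_le_prod' fun j _ =>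
        (card_quotient_annihilator_le_of_normal hH hnorm hφ hgen hW j i).trans
          (card_quotient_annihilator_le hφ hgen hW j)
  refine ⟨Nat.log t q,
    (card_pow_le_of_le hAt (Nat.pow_log_le_self t Nat.card_pos.ne')).trans hqV, ?_⟩
  intro S hS v hv hv0 z
  refine mem_sumsOfAtMost_of_card_bounds hH hφ hgen hW (B := MonoidHom.mrange φ) ?_
    (fun a => ⟨a, rfl⟩) i ht2 le_rfl (fun j => Or.inl (hi' j)) (fun j => ?_) hS ?_ hv hv0 z
  · rintro _ ⟨a, rfl⟩
    exact (Group.isUnit a).map φ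
  · exact (card_quotient_annihilator_le_of_normal hH hnorm hφ hgen hW i j).trans_lt
      (Nat.lt_pow_succ_log_self (by omega) _)
  · rintro _ ⟨a, rfl⟩ s hs
    rw [hφ]
    exact hS a (hAH a.2) s hs

/-- The group algebra of an abelian linear group acts on the natural module. -/
lemma exists_commRing_module_of_comm.{u} {V : Type u} [AddCommGroup V] [Module (ZMod p) V]
    [Finite V] (A : Subgroup (V ≃ₗ[ZMod p] V)) (hAcomm : ∀ a ∈ A, ∀ b ∈ A, a * b = b * a) :
    ∃ (R : Type u) (_ : CommRing R) (_ : Module R V) (_ : Finite R) (φ : A →* R),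
      (∀ a v, φ a • v = (a : V ≃ₗ[ZMod p] V) v) ∧ AddSubmonoid.closure (Set.range φ) = ⊤ := by
  have hcomm : IsMulCommutative A := ⟨⟨fun a b => Subtype.ext (hAcomm a a.2 b b.2)⟩⟩
  let : CommGroup A := { (inferInstance : Group A) with mul_comm := hcomm.is_comm.comm }
  have hAfin : Finite A := by
    have : Finite (V ≃ₗ[ZMod p] V) := DFunLike.finite _
    infer_instance
  have : Finite (A →₀ ZMod p) := DFunLike.finite _
  let m : Module (MonoidAlgebra (ZMod p) A) V :=
    Module.compHom V (Representation.asAlgebraHom (naturalRep A)).toRingHom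
  refine ⟨MonoidAlgebra (ZMod p) A, inferInstance, m,
    Finite.of_injective MonoidAlgebra.coeff fun x y h => MonoidAlgebra.coeff_injective h,
    MonoidAlgebra.of (ZMod p) A, fun a v => ?_, ?_⟩
  · change Representation.asAlgebraHom (naturalRep A) (MonoidAlgebra.of (ZMod p) A a) v = _
    rw [Representation.asAlgebraHom_of]
    rfl
  · refine top_unique fun x _ => ?_
    induction x using MonoidAlgebra.induction_linear with
    | zero => exact zero_mem _
    | add x y hx hy => exact add_mem (hx trivial) (hy trivial)
    | single a c =>
      -- Coefficients modulo `p` are natural multiples, so no negatives are needed to generate.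
      have : MonoidAlgebra.single a c = c.val • MonoidAlgebra.of (ZMod p) A a := by
        rw [MonoidAlgebra.of_apply, MonoidAlgebra.smul_single, nsmul_one, ZMod.natCast_zmod_val]
      rw [this]
      exact nsmul_mem (AddSubmonoid.subset_closure (Set.mem_range_self a)) _

end filling

/-! ### Orbital graphs as Cayley graphs -/

section graph

variable {F V : Type*} [Field F] [AddCommGroup V] [Module F V] {H : Subgroup (V ≃ₗ[F] V)}

lemma orbitalGraph_adj_of_apply_eq_sub {a : V × V} {h : V ≃ₗ[F] V} (hh : h ∈ H) {x y : V}
    (hxy : h (a.2 - a.1) = y - x) : (orbitalGraph (affinePermGroup H) a).Adj x y := by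
  have hg : h.toEquiv.trans (Equiv.addRight (x - h a.1)) ∈ affinePermGroup H :=
    ⟨h, hh, x - h a.1, fun z => rfl⟩
  refine ⟨⟨_, hg⟩, Prod.ext ?_ ?_⟩
  · change h a.1 + (x - h a.1) = x
    abel
  · change h a.2 + (x - h a.1) = y
    rw [map_sub] at hxy
    rw [← sub_add_cancel y x, ← hxy]
    abel

lemma sub_ne_zero_of_isNonDiagonalOrbital {a : V × V}
    (ha : IsNonDiagonalOrbital (affinePermGroup H) a) : a.2 - a.1 ≠ 0 := by
  obtain ⟨x, y, ⟨g, hg⟩, hxy⟩ := ha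
  intro h0
  refine hxy ?_
  have hx : g.1 a.1 = x := (Prod.ext_iff.1 hg).1
  have hy : g.1 a.2 = y := (Prod.ext_iff.1 hg).2
  rw [← hx, ← hy, sub_eq_zero.1 h0]

lemma hasDirectedWalk_of_list {D : Digraph V} {S : Set V}
    (hD : ∀ x, ∀ s ∈ S, D.Adj x (x + s)) (l : List V) (hl : ∀ s ∈ l, s ∈ S) (x : V) :
    HasDirectedWalk D l.length x (x + l.sum) := by
  refine ⟨fun i => x + (l.take i).sum, by simp, by simp, fun i hi => ?_⟩
  beta_reduce
  rw [List.sum_take_succ l i hi, ← add_assoc]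
  exact hD _ _ (hl _ (List.getElem_mem hi))

lemma directedDist_le_of_mem_sumsOfAtMost {D : Digraph V} {S : Set V}
    (hD : ∀ x, ∀ s ∈ S, D.Adj x (x + s)) {n : ℕ} {x y : V} (h : y - x ∈ sumsOfAtMost S n) :
    directedDist D x y ≤ n := by
  obtain ⟨m, hm, hS, hsum⟩ := h
  have hw := hasDirectedWalk_of_list hD m.toList (fun s hs => hS s (Multiset.mem_toList.1 hs)) x
  rw [Multiset.sum_toList, hsum, add_sub_cancel, Multiset.length_toList] at hw
  exact (iInf_le (fun n : {n : ℕ // HasDirectedWalk D n x y} => ((n : ℕ) : ℕ∞)) ⟨_, hw⟩).trans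
    (by exact_mod_cast hm)

lemma edist_le_of_mem_sumsOfAtMost {G : SimpleGraph V} {S : Set V}
    (hG : ∀ x, ∀ s ∈ S, x ≠ x + s → G.Adj x (x + s)) {n : ℕ} {x y : V}
    (h : y - x ∈ sumsOfAtMost S n) : G.edist x y ≤ n := by
  obtain ⟨m, hm, hS, hsum⟩ := h
  have key : G.edist x (x + m.sum) ≤ m.card := by
    clear hsum hm
    induction m using Multiset.induction_on with
    | empty => simp
    | cons s m ih =>
      have h1 := ih fun y hy => hS y (Multiset.mem_cons_of_mem hy)
      have h2 : G.edist (x + m.sum) (x + m.sum + s) ≤ 1 := by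
        by_cases heq : x + m.sum = x + m.sum + s
        · rw [← heq, SimpleGraph.edist_self]
          exact zero_le
        · exact (SimpleGraph.edist_eq_one_iff_adj.2
            (hG _ s (hS s (Multiset.mem_cons_self s m)) heq)).le
      rw [Multiset.sum_cons, Multiset.card_cons, add_comm s, ← add_assoc, Nat.cast_add,
        Nat.cast_one]
      exact SimpleGraph.edist_triangle.trans (add_le_add h1 h2)
  rw [hsum, add_sub_cancel] at key
  exact key.trans (by exact_mod_cast hm)

lemma directedOrbitalDiam_le {n : ℕ}
    (hn : ∀ S : Set V, (∀ h ∈ H, ∀ s ∈ S, h s ∈ S) → ∀ v ∈ S, v ≠ 0 →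
      ∀ z, z ∈ sumsOfAtMost S n) :
    directedOrbitalDiam (affinePermGroup H) ≤ n := by
  refine iSup₂_le fun a ha => iSup₂_le fun x y => ?_
  refine directedDist_le_of_mem_sumsOfAtMost (S := {w | ∃ h ∈ H, h (a.2 - a.1) = w}) ?_
    (hn {w | ∃ h ∈ H, h (a.2 - a.1) = w} ?_ (a.2 - a.1) ⟨1, H.one_mem, rfl⟩ (sub_ne_zero_of_isNonDiagonalOrbital ha) (y - x))
  · rintro x _ ⟨h, hh, rfl⟩
    exact orbitalGraph_adj_of_apply_eq_sub hh (by abel)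
  · rintro g hg _ ⟨h, hh, rfl⟩
    exact ⟨g * h, H.mul_mem hg hh, rfl⟩

lemma undirectedOrbitalDiam_le {n : ℕ}
    (hn : ∀ S : Set V, (∀ h ∈ H, ∀ s ∈ S, h s ∈ S) → (∀ s ∈ S, -s ∈ S) → ∀ v ∈ S, v ≠ 0 →
      ∀ z, z ∈ sumsOfAtMost S n) :
    undirectedOrbitalDiam (affinePermGroup H) ≤ n := by
  refine iSup₂_le fun a ha => SimpleGraph.ediam_le_of_edist_le fun x y => ?_
  refine edist_le_of_mem_sumsOfAtMost
    (S := {w | ∃ h ∈ H, h (a.2 - a.1) = w ∨ h (a.2 - a.1) = -w}) ?_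
    (hn {w | ∃ h ∈ H, h (a.2 - a.1) = w ∨ h (a.2 - a.1) = -w} ?_ ?_ (a.2 - a.1) ⟨1, H.one_mem, Or.inl rfl⟩
      (sub_ne_zero_of_isNonDiagonalOrbital ha) (y - x))
  · rintro x s ⟨h, hh, hs | hs⟩ hne
    · exact ⟨hne, Or.inl (orbitalGraph_adj_of_apply_eq_sub hh (by rw [hs]; abel))⟩
    · exact ⟨hne, Or.inr (orbitalGraph_adj_of_apply_eq_sub hh (by rw [hs]; abel))⟩
  · rintro g hg w ⟨h, hh, hw⟩
    refine ⟨g * h, H.mul_mem hg hh, ?_⟩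
    rw [LinearEquiv.mul_apply]
    rcases hw with hw | hw
    · exact Or.inl (by rw [hw])
    · exact Or.inr (by rw [hw, map_neg])
  · rintro w ⟨h, hh, hw⟩
    refine ⟨h, hh, ?_⟩
    rw [neg_neg]
    exact hw.symm

end graph

/-! ### Numerical estimates and conclusion -/

/-- From `L + 1 ≤ k * exp (L / k)` and `exp 1 < 4`. This trades the polynomial factor for one extra
power `4 ^ L`, the source of `k + 1` in the exponents. -/
lemma add_one_pow_le (k L : ℕ) (hk : 1 ≤ k) : (L + 1) ^ k ≤ k ^ k * 4 ^ L := by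
  have hk0 : (0 : ℝ) < k := by exact_mod_cast hk
  have h1 : (L : ℝ) + 1 ≤ k * Real.exp (L / k) := by
    have h2 := Real.add_one_le_exp ((L : ℝ) / k)
    have h3 : (1 : ℝ) ≤ k := by exact_mod_cast hk
    calc (L : ℝ) + 1 ≤ L + k := by linarith
      _ = k * (L / k + 1) := by field_simp
      _ ≤ _ := mul_le_mul_of_nonneg_left h2 hk0.le
  have h4 : ((L : ℝ) + 1) ^ k ≤ (k : ℝ) ^ k * 4 ^ L := by
    calc ((L : ℝ) + 1) ^ k ≤ (k * Real.exp (L / k)) ^ k := pow_le_pow_left₀ (by positivity) h1 k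
      _ = (k : ℝ) ^ k * Real.exp 1 ^ L := by
        rw [mul_pow, ← Real.exp_nat_mul, ← Real.exp_nat_mul]
        congr 2
        field_simp
      _ ≤ _ := by
        refine mul_le_mul_of_nonneg_left (pow_le_pow_left₀ (Real.exp_pos 1).le ?_ L) (by positivity)
        linarith [Real.exp_one_lt_d9]
  exact_mod_cast h4

lemma lineLength_le (k L : ℕ) (hk : 1 ≤ k) :
    lineLength k L ≤ 144 ^ (k * (k + 1)) * 4 ^ (L * (k + 1)) := by
  have h1 : lineLength k L ≤ (3 * sumLength L) ^ k := by
    obtain ⟨k, rfl⟩ : ∃ k', k = k' + 1 := ⟨k - 1, by omega⟩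
    rw [lineLength, Nat.add_sub_cancel, pow_succ]
    exact Nat.mul_le_mul_left _ (by omega)
  have h2 : 288 * k ≤ 144 ^ (k + 1) := by
    have h3 : 2 * k ≤ 144 ^ k := by
      have : k < 2 ^ k := Nat.lt_two_pow_self
      calc 2 * k ≤ 2 ^ k * 2 ^ k := Nat.mul_le_mul (Nat.le_self_pow (by omega) 2) this.le
        _ = 4 ^ k := by rw [← mul_pow]; norm_num
        _ ≤ 144 ^ k := Nat.pow_le_pow_left (by omega) k
    rw [pow_succ]
    omega
  calc lineLength k L ≤ (3 * sumLength L) ^ k := h1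
    _ = 288 ^ k * (L + 1) ^ k * 4 ^ (L * k) := by
      rw [sumLength, pow_mul, ← mul_pow, ← mul_pow]
      congr 1
      ring
    _ ≤ 288 ^ k * (k ^ k * 4 ^ L) * 4 ^ (L * k) :=
      Nat.mul_le_mul_right _ (Nat.mul_le_mul_left _ (add_one_pow_le k L hk))
    _ = (288 * k) ^ k * 4 ^ (L * (k + 1)) := by rw [mul_pow, mul_add, mul_one, pow_add]; ring
    _ ≤ (144 ^ (k + 1)) ^ k * 4 ^ (L * (k + 1)) :=
      Nat.mul_le_mul_right _ (Nat.pow_le_pow_left h2 k)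
    _ = _ := by rw [← pow_mul, mul_comm k (k + 1)]

/-- Take logarithms. It is used with `e = k` in general and `e = 1` for normal `A`. -/
lemma four_pow_le_rpow {a v L e : ℕ} (ha : 1 < a) (hv : 1 ≤ v) (h : a ^ L ≤ v ^ e) (m : ℕ) :
    (4 : ℝ) ^ (L * m) ≤ (v : ℝ) ^ ((e : ℝ) * m * Real.log 4 / Real.log a) := by
  have hv0 : (0 : ℝ) < v := by exact_mod_cast hv
  have ha0 : (0 : ℝ) < a := by exact_mod_cast (zero_lt_one.trans ha)
  have hla : 0 < Real.log a := Real.log_pos (by exact_mod_cast ha)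
  have h1 : (L : ℝ) * Real.log a ≤ e * Real.log v := by
    rw [← Real.log_pow, ← Real.log_pow]
    exact Real.log_le_log (by positivity) (by exact_mod_cast h)
  have h4 : 0 < Real.log 4 := Real.log_pos (by norm_num)
  rw [← Real.log_le_log_iff (by positivity) (Real.rpow_pos_of_pos hv0 _), Real.log_pow,
    Real.log_rpow hv0, div_mul_eq_mul_div, le_div_iff₀ hla]
  calc ((L * m : ℕ) : ℝ) * Real.log 4 * Real.log a = (L * Real.log a) * (m * Real.log 4) := by
        push_cast; ring
    _ ≤ (e * Real.log v) * (m * Real.log 4) := mul_le_mul_of_nonneg_right h1 (by positivity)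
    _ = _ := by ring

theorem theorem1p2 (p : ℕ) [Fact p.Prime] {V : Type*} [AddCommGroup V] [Module (ZMod p) V]
    [Module.Finite (ZMod p) V]
    (H : Subgroup (V ≃ₗ[ZMod p] V)) (hH : (naturalRep H).IsIrreducible)
    (A : Subgroup (V ≃ₗ[ZMod p] V)) (hAH : A ≤ H) (hA : A ≠ ⊥)
    (hAcomm : ∀ a ∈ A, ∀ b ∈ A, a * b = b * a) (hAp : ¬ p ∣ Nat.card A)
    (k : ℕ) (W : Fin k → Subrepresentation (naturalRep A))
    (hW : IsIrreducibleDecomposition (naturalRep A) W) :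
    (∃ n : ℕ, undirectedOrbitalDiam (affinePermGroup H) = n ∧
      (n : ℝ) < 322 * (Module.finrank (ZMod p) V : ℝ) * (144 : ℝ) ^ (k * (k + 1)) *
        (Nat.card V : ℝ) ^
          ((k : ℝ) * ((k : ℝ) + 1) * Real.log 4 / Real.log (Nat.card A : ℝ))) ∧
    ((A.subgroupOf H).Normal →
      ∃ n : ℕ, directedOrbitalDiam (affinePermGroup H) = n ∧
        (n : ℝ) < (Module.finrank (ZMod p) V : ℝ) * (2576 : ℝ) ^ (k * (k + 1)) *
          (Nat.card V : ℝ) ^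
            (((k : ℝ) + 1) * Real.log 4 / Real.log (Nat.card A : ℝ))) := by
  have : Finite V := Module.finite_of_finite (ZMod p)
  have : Finite (V ≃ₗ[ZMod p] V) := DFunLike.finite _
  have hA1 : 1 < Nat.card A := (Subgroup.one_lt_card_iff_ne_bot A).2 hA
  have : Nontrivial V := by
    by_contra h
    rw [not_nontrivial_iff_subsingleton] at h
    exact hA ((Subgroup.eq_bot_iff_forall A).2 fun a _ => LinearEquiv.ext fun v => h.elim _ _)
  have hd : 0 < Module.finrank (ZMod p) V := Module.finrank_pos
  have hd' : (0 : ℝ) < Module.finrank (ZMod p) V := by exact_mod_cast hd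
  have hV : 1 ≤ Nat.card V := Nat.card_pos
  have hV' : (0 : ℝ) < Nat.card V := by exact_mod_cast hV
  have hk : 1 ≤ k := by
    by_contra hk
    obtain rfl : k = 0 := by omega
    have h1 := prod_card_summand hW
    rw [Finset.prod_of_isEmpty] at h1
    exact (Finite.one_lt_card (α := V)).ne h1
  obtain ⟨R, _, _, _, φ, hφ, hgen⟩ := exists_commRing_module_of_comm A hAcomm
  constructor
  · obtain ⟨L, hL, hS⟩ := exists_forall_mem_sumsOfAtMost_of_neg_mem hH hAH hA1 hφ hgen hW
    have hle := undirectedOrbitalDiam_le (H := H) hS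
    obtain ⟨n, hn, hnle⟩ := ENat.le_natCast_iff.1 hle
    refine ⟨n, hn, ?_⟩
    have h4 := four_pow_le_rpow hA1 hV hL (k + 1)
    push_cast at h4
    set X := (Nat.card V : ℝ) ^
      ((k : ℝ) * ((k : ℝ) + 1) * Real.log 4 / Real.log (Nat.card A : ℝ)) with hX
    have hX0 : 0 < X := Real.rpow_pos_of_pos hV' _
    have hline : (lineLength k L : ℝ) ≤ 144 ^ (k * (k + 1)) * 4 ^ (L * (k + 1)) := by
      exact_mod_cast lineLength_le k L hk
    calc (n : ℝ) ≤ Module.finrank (ZMod p) V * lineLength k L := by exact_mod_cast hnle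
      _ ≤ Module.finrank (ZMod p) V * (144 ^ (k * (k + 1)) * X) := by
        refine mul_le_mul_of_nonneg_left (hline.trans ?_) hd'.le
        exact mul_le_mul_of_nonneg_left h4 (by positivity)
      -- The argument yields the bound with constant `1`; `322` only provides strictness.
      _ < 322 * (Module.finrank (ZMod p) V * (144 ^ (k * (k + 1)) * X)) := by
        have : 0 < Module.finrank (ZMod p) V * (144 ^ (k * (k + 1)) * X) := by positivity
        linarith
      _ = _ := by ring
  · intro hnormal
    have hnorm : ∀ h ∈ H, ∀ a ∈ A, h * a * h⁻¹ ∈ A := fun h hh a ha =>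
      Subgroup.mem_subgroupOf.1
        (hnormal.conj_mem ⟨a, hAH ha⟩ (Subgroup.mem_subgroupOf.2 ha) ⟨h, hh⟩)
    obtain ⟨L, hL, hS⟩ := exists_forall_mem_sumsOfAtMost_of_normal hH hAH hA1 hnorm hφ hgen hW
    have hle := directedOrbitalDiam_le (H := H) hS
    obtain ⟨n, hn, hnle⟩ := ENat.le_natCast_iff.1 hle
    refine ⟨n, hn, ?_⟩
    have h4 := four_pow_le_rpow (L := L) (e := 1) hA1 hV (by rwa [pow_one]) (k + 1)
    push_cast at h4
    rw [one_mul] at h4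
    set X := (Nat.card V : ℝ) ^
      (((k : ℝ) + 1) * Real.log 4 / Real.log (Nat.card A : ℝ)) with hX
    have hX0 : 0 < X := Real.rpow_pos_of_pos hV' _
    have hline : (lineLength k L : ℝ) ≤ 144 ^ (k * (k + 1)) * 4 ^ (L * (k + 1)) := by
      exact_mod_cast lineLength_le k L hk
    calc (n : ℝ) ≤ Module.finrank (ZMod p) V * lineLength k L := by exact_mod_cast hnle
      _ ≤ Module.finrank (ZMod p) V * (144 ^ (k * (k + 1)) * X) := by
        refine mul_le_mul_of_nonneg_left (hline.trans ?_) hd'.le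
        exact mul_le_mul_of_nonneg_left h4 (by positivity)
      -- Strict because `144 < 2576` and `k ≥ 1` makes the exponent nonzero.
      _ < Module.finrank (ZMod p) V * (2576 ^ (k * (k + 1)) * X) := by
        refine mul_lt_mul_of_pos_left (mul_lt_mul_of_pos_right ?_ hX0) hd'
        exact pow_lt_pow_left₀ (by norm_num) (by norm_num) (by positivity)
      _ = _ := by ring
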